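/- **Theorem (sharp $L^4$ Strichartz estimate).** Let $\mathbb{T}=\mathbb{R}/\mathbb{Z}$ and $\square=\partial_{x_1}^2-\partial_{x_2}^2$ on $\mathbb{R}\times\mathbb{T}$. For $\phi\in L^2(\mathbb{R}\times\mathbb{T})$ let $e^{it\square}\phi$ denote the solution of the linear hyperbolic Schrödinger equation $i\partial_t u+\square u=0$, $u(0,\cdot)=\phi$, that is, the function whose Fourier transform at $(\xi_1,n)\in\mathbb{R}\times\mathbb{Z}$ is $e^{-4\pi^2 i t(\xi_1^2-n^2)}\,\widehat\phi(\xi_1,n)$, where $\widehat\phi(\xi_1,n)=\int_{\mathbb{R}\times\mathbb{T}}\phi(x)e^{-2\pi i(x_1\xi_1+x_2n)}\,dx$ (extended to $L^2$ by Plancherel's theorem). Then there is an absolute constant $C$ such that $$\|e^{it\square}\phi\|_{L^4_{t,x}([0,1]\times\mathbb{R}\times\mathbb{T})}\le C\,\|\phi\|_{L^2_x(\mathbb{R}\times\mathbb{T})}\qquad\text{for all }\phi\in L^2(\mathbb{R}\times\mathbb{T}).$$ -/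

import Mathlib

open MeasureTheory FourierTransform
open scoped ENNReal NNReal

/-- The cylinder `ℝ × 𝕋` with `𝕋 = ℝ / ℤ`, carrying the product of the Lebesgue measures. -/
abbrev Cylinder : Type := ℝ × UnitAddCircle

/-- The complex Hilbert space `L²(ℝ)`. -/
abbrev L2Line : Type := Lp ℂ 2 (volume : Measure ℝ)

/-- The complex Hilbert space `L²(ℝ × 𝕋)`. -/
abbrev L2Cylinder : Type := Lp ℂ 2 (volume : Measure Cylinder)

theorem volume_unitAddCircle :
    (volume : Measure UnitAddCircle) = AddCircle.haarAddCircle := by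
  have h := AddCircle.volume_eq_smul_haarAddCircle (T := 1)
  simpa using h

theorem norm_fourier_apply (n : ℤ) (x : UnitAddCircle) : ‖(fourier n x : ℂ)‖ = 1 := by
  rw [fourier_apply, Circle.norm_coe]

theorem isProbabilityMeasure_unitAddCircle :
    IsProbabilityMeasure (volume : Measure UnitAddCircle) := by
  rw [volume_unitAddCircle]; infer_instance

/-- The `n`-th Fourier coefficient in the periodic variable, as a function on the line:
`x₁ ↦ ∫_𝕋 φ(x₁, x₂) e^{-2πi n x₂} dx₂`. -/
noncomputable def partialCoeffFun (φ : Cylinder → ℂ) (n : ℤ) (x₁ : ℝ) : ℂ :=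
  ∫ x₂ : UnitAddCircle, fourier (-n) x₂ * φ (x₁, x₂)

theorem memLp_partialCoeffFun (φ : L2Cylinder) (n : ℤ) :
    MemLp (partialCoeffFun φ n) 2 (volume : Measure ℝ) := by
  have := isProbabilityMeasure_unitAddCircle
  have hφ : MemLp φ 2 ((volume : Measure ℝ).prod (volume : Measure UnitAddCircle)) := Lp.memLp φ
  have hm : AEStronglyMeasurable (fun p : Cylinder => fourier (-n) p.2 * φ p)
      ((volume : Measure ℝ).prod (volume : Measure UnitAddCircle)) :=
    (((fourier (-n)).continuous.comp continuous_snd).aestronglyMeasurable).mul hφ.1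
  refine ⟨hm.integral_prod_right', ?_⟩
  rw [eLpNorm_lt_top_iff_lintegral_rpow_enorm_lt_top (by norm_num) (by norm_num)]
  have hlt := (eLpNorm_lt_top_iff_lintegral_rpow_enorm_lt_top (by norm_num) (by norm_num)).1 hφ.2
  have hfib := hφ.1.prodMk_left
  rw [lintegral_prod _ (hφ.1.enorm.pow_const _)] at hlt
  refine lt_of_le_of_lt (lintegral_mono_ae ?_) hlt
  filter_upwards [hfib] with x hx
  have h1 : ‖partialCoeffFun φ n x‖ₑ ≤ eLpNorm (fun y => φ (x, y)) 1 volume := by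
    refine (enorm_integral_le_lintegral_enorm _).trans ?_
    rw [eLpNorm_one_eq_lintegral_enorm]
    refine lintegral_mono fun y => ?_
    rw [enorm_mul, ← ofReal_norm (fourier (-n) y), norm_fourier_apply, ENNReal.ofReal_one,
      one_mul]
  have h2 := h1.trans (eLpNorm_le_eLpNorm_of_exponent_le (q := 2) (by norm_num) hx)
  rw [eLpNorm_eq_lintegral_rpow_enorm_toReal (by norm_num) (by norm_num)] at h2
  calc ‖partialCoeffFun φ n x‖ₑ ^ (2 : ℝ≥0∞).toReal
      ≤ ((∫⁻ y : UnitAddCircle, ‖φ (x, y)‖ₑ ^ (2 : ℝ≥0∞).toReal) ^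
          (1 / (2 : ℝ≥0∞).toReal)) ^ (2 : ℝ≥0∞).toReal := by gcongr
    _ = _ := by rw [← ENNReal.rpow_mul]; simp

/-- `partialCoeffFun` as an element of `L²(ℝ)`. -/
noncomputable def partialCoeff (φ : L2Cylinder) (n : ℤ) : L2Line :=
  (memLp_partialCoeffFun φ n).toLp (partialCoeffFun φ n)

/-- The Fourier transform on `ℝ × 𝕋`: `cylinderFourier φ n` is the function
`ξ₁ ↦ φ̂(ξ₁, n) = ∫_{ℝ × 𝕋} φ(x) e^{-2πi (x₁ ξ₁ + x₂ n)} dx` in `L²(ℝ)`, where the integral in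
`x₁` is the Fourier transform on `L²(ℝ)` (the Plancherel extension). -/
noncomputable def cylinderFourier (φ : L2Cylinder) (n : ℤ) : L2Line :=
  𝓕 (partialCoeff φ n)

/-- The symbol of `exp (i t (∂₁² - ∂₂²))` at the frequency `(ξ₁, n)`. Since `∂ⱼ²` acts on
`e^{2πi x·ξ}` as `-4π² ξⱼ²`, it is `exp (-4π² i t (ξ₁² - n²))`. -/
noncomputable def flowSymbol (t : ℝ) (n : ℤ) (ξ₁ : ℝ) : ℂ :=
  Complex.exp (((-4 * Real.pi ^ 2 * t * (ξ₁ ^ 2 - (n : ℝ) ^ 2) : ℝ) : ℂ) * Complex.I)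

theorem norm_flowSymbol (t : ℝ) (n : ℤ) (ξ₁ : ℝ) : ‖flowSymbol t n ξ₁‖ = 1 :=
  Complex.norm_exp_ofReal_mul_I _

theorem continuous_flowSymbol (t : ℝ) (n : ℤ) : Continuous (flowSymbol t n) := by
  unfold flowSymbol; fun_prop

theorem memLp_flowSymbol_mul (t : ℝ) (n : ℤ) (g : L2Line) :
    MemLp (fun ξ => flowSymbol t n ξ * g ξ) 2 (volume : Measure ℝ) :=
  (Lp.memLp g).of_le ((continuous_flowSymbol t n).aestronglyMeasurable.mul (Lp.memLp g).1)
    (Filter.Eventually.of_forall fun ξ => by simp [norm_flowSymbol])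

/-- Multiplication by the symbol at the periodic frequency `n`, on `L²(ℝ)`. -/
noncomputable def mulFlowSymbol (t : ℝ) (n : ℤ) (g : L2Line) : L2Line :=
  (memLp_flowSymbol_mul t n g).toLp (fun ξ => flowSymbol t n ξ * g ξ)

theorem memLp_tensorMode (g : L2Line) (n : ℤ) :
    MemLp (fun x : Cylinder => g x.1 * fourier n x.2) 2 (volume : Measure Cylinder) := by
  have := isProbabilityMeasure_unitAddCircle
  have hg : MemLp (fun x : Cylinder => g x.1) 2
      ((volume : Measure ℝ).prod (volume : Measure UnitAddCircle)) := (Lp.memLp g).comp_fst _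
  exact hg.of_le
    (hg.1.mul ((fourier n).continuous.comp continuous_snd).aestronglyMeasurable)
    (Filter.Eventually.of_forall fun x => by rw [norm_mul, norm_fourier_apply, mul_one])

/-- The function `(x₁, x₂) ↦ g(x₁) e^{2πi n x₂}` in `L²(ℝ × 𝕋)`. -/
noncomputable def tensorMode (g : L2Line) (n : ℤ) : L2Cylinder :=
  (memLp_tensorMode g n).toLp (fun x : Cylinder => g x.1 * fourier n x.2)

/-- The part of the evolution at the periodic frequency `n`:
`(∫_ℝ e^{2πi x₁ ξ₁} e^{-4π² i t (ξ₁² - n²)} φ̂(ξ₁, n) dξ₁) e^{2πi n x₂}`. -/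
noncomputable def flowMode (t : ℝ) (φ : L2Cylinder) (n : ℤ) : L2Cylinder :=
  tensorMode (𝓕⁻ (mulFlowSymbol t n (cylinderFourier φ n))) n

theorem coeFn_tensorMode (g : L2Line) (n : ℤ) :
    tensorMode g n =ᵐ[volume] fun x : Cylinder => g x.1 * fourier n x.2 :=
  (memLp_tensorMode g n).coeFn_toLp

theorem inner_tensorMode (g h : L2Line) (m n : ℤ) :
    inner ℂ (tensorMode g m) (tensorMode h n) = if m = n then inner ℂ g h else 0 := by
  have := isProbabilityMeasure_unitAddCircle
  have h1 : inner ℂ (tensorMode g m) (tensorMode h n) =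
      ∫ x : Cylinder, inner ℂ (g x.1) (h x.1) * (fourier (-m) x.2 * fourier n x.2) := by
    rw [L2.inner_def]
    refine integral_congr_ae ?_
    filter_upwards [coeFn_tensorMode g m, coeFn_tensorMode h n] with x hx hy
    rw [hx, hy, fourier_neg]
    simp only [RCLike.inner_apply, map_mul]
    ring
  rw [h1, Measure.volume_eq_prod,
    integral_prod_mul (fun x : ℝ => inner ℂ (g x) (h x))
      (fun y : UnitAddCircle => (fourier (-m) y * fourier n y : ℂ)), ← L2.inner_def]
  have h2 : ∫ y : UnitAddCircle, (fourier (-m) y * fourier n y : ℂ) = if m = n then 1 else 0 := by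
    have h3 := (orthonormal_iff_ite.1 (orthonormal_fourier (T := 1))) m n
    rw [ContinuousMap.inner_toLp AddCircle.haarAddCircle (fourier m) (fourier n)] at h3
    rw [volume_unitAddCircle, ← h3]
    refine integral_congr_ae (Filter.Eventually.of_forall fun y => ?_)
    simp only [fourier_neg]
    ring
  rw [h2]
  split_ifs <;> simp

theorem tensorMode_add (g h : L2Line) (n : ℤ) :
    tensorMode (g + h) n = tensorMode g n + tensorMode h n := by
  have := isProbabilityMeasure_unitAddCircle
  have hae : ∀ᵐ x : Cylinder, (g + h : L2Line) x.1 = g x.1 + h x.1 :=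
    Measure.quasiMeasurePreserving_fst.ae (Lp.coeFn_add g h)
  refine Lp.ext ?_
  filter_upwards [coeFn_tensorMode (g + h) n, coeFn_tensorMode g n, coeFn_tensorMode h n,
    Lp.coeFn_add (tensorMode g n) (tensorMode h n), hae] with x h1 h2 h3 h4 h5
  rw [h1, h4, Pi.add_apply, h2, h3, h5]
  ring

theorem tensorMode_smul (c : ℂ) (g : L2Line) (n : ℤ) :
    tensorMode (c • g) n = c • tensorMode g n := by
  have := isProbabilityMeasure_unitAddCircle
  have hae : ∀ᵐ x : Cylinder, (c • g : L2Line) x.1 = c * g x.1 :=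
    Measure.quasiMeasurePreserving_fst.ae (Lp.coeFn_smul c g)
  refine Lp.ext ?_
  filter_upwards [coeFn_tensorMode (c • g) n, coeFn_tensorMode g n,
    Lp.coeFn_smul c (tensorMode g n), hae] with x h1 h2 h4 h5
  rw [h1, h4, Pi.smul_apply, h2, h5, smul_eq_mul]
  ring

theorem norm_tensorMode (g : L2Line) (n : ℤ) : ‖tensorMode g n‖ = ‖g‖ := by
  rw [@norm_eq_sqrt_re_inner ℂ, inner_tensorMode, if_pos rfl, ← @norm_eq_sqrt_re_inner ℂ]

/-- `tensorMode · n` as a linear isometry from `L²(ℝ)` to `L²(ℝ × 𝕋)`. -/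
noncomputable def tensorModeIsometry (n : ℤ) : L2Line →ₗᵢ[ℂ] L2Cylinder where
  toFun g := tensorMode g n
  map_add' g h := tensorMode_add g h n
  map_smul' c g := tensorMode_smul c g n
  norm_map' g := norm_tensorMode g n

theorem orthogonalFamily_tensorMode :
    OrthogonalFamily ℂ (fun _ : ℤ => L2Line) tensorModeIsometry := by
  intro m n hmn g h
  exact (inner_tensorMode g h m n).trans (if_neg hmn)

theorem norm_mulFlowSymbol (t : ℝ) (n : ℤ) (g : L2Line) : ‖mulFlowSymbol t n g‖ = ‖g‖ := by
  rw [mulFlowSymbol, Lp.norm_toLp, Lp.norm_def]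
  congr 1
  exact eLpNorm_congr_norm_ae (Filter.Eventually.of_forall fun ξ => by
    rw [norm_mul, norm_flowSymbol, one_mul])

theorem norm_fourierInv_mulFlowSymbol (t : ℝ) (φ : L2Cylinder) (n : ℤ) :
    ‖(𝓕⁻ (mulFlowSymbol t n (cylinderFourier φ n)) : L2Line)‖ = ‖partialCoeff φ n‖ := by
  rw [← Lp.norm_fourier_eq, fourier_fourierInv_eq, norm_mulFlowSymbol, cylinderFourier,
    Lp.norm_fourier_eq]

theorem partialCoeff_tensorMode_inner (φ : L2Cylinder) (g : L2Line) (n : ℤ) :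
    inner ℂ (tensorMode g n) φ = inner ℂ g (partialCoeff φ n) := by
  have := isProbabilityMeasure_unitAddCircle
  have hint : Integrable (fun x : Cylinder => inner ℂ (g x.1) (fourier (-n) x.2 * φ x))
      ((volume : Measure ℝ).prod (volume : Measure UnitAddCircle)) := by
    refine (L2.integrable_inner (𝕜 := ℂ) (tensorMode g n) φ).congr ?_
    filter_upwards [coeFn_tensorMode g n] with x hx
    rw [hx, fourier_neg]
    simp only [RCLike.inner_apply, map_mul]
    ring
  rw [L2.inner_def, L2.inner_def]
  calc ∫ x : Cylinder, inner ℂ (tensorMode g n x) (φ x)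
      = ∫ x : Cylinder, inner ℂ (g x.1) (fourier (-n) x.2 * φ x) := by
        refine integral_congr_ae ?_
        filter_upwards [coeFn_tensorMode g n] with x hx
        rw [hx, fourier_neg]
        simp only [RCLike.inner_apply, map_mul]
        ring
    _ = ∫ x₁ : ℝ, ∫ x₂ : UnitAddCircle, inner ℂ (g x₁) (fourier (-n) x₂ * φ (x₁, x₂)) :=
        integral_prod _ hint
    _ = ∫ x₁ : ℝ, inner ℂ (g x₁) (partialCoeff φ n x₁) := by
        refine integral_congr_ae ?_
        filter_upwards [(memLp_partialCoeffFun φ n).coeFn_toLp] with x hx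
        rw [partialCoeff, hx, partialCoeffFun]
        simp only [RCLike.inner_apply]
        rw [integral_mul_const]

theorem sum_sq_norm_partialCoeff_le (φ : L2Cylinder) (s : Finset ℤ) :
    ∑ n ∈ s, ‖partialCoeff φ n‖ ^ 2 ≤ ‖φ‖ ^ 2 := by
  have h1 : ∀ n, RCLike.re (inner ℂ (tensorMode (partialCoeff φ n) n) φ) =
      ‖partialCoeff φ n‖ ^ 2 := fun n => by
    rw [partialCoeff_tensorMode_inner, inner_self_eq_norm_sq]
  have h2 : ‖∑ n ∈ s, tensorMode (partialCoeff φ n) n‖ ^ 2 = ∑ n ∈ s, ‖partialCoeff φ n‖ ^ 2 :=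
    orthogonalFamily_tensorMode.norm_sum (fun n => partialCoeff φ n) s
  have h3 := @norm_sub_sq ℂ _ _ _ _ (∑ n ∈ s, tensorMode (partialCoeff φ n) n) φ
  rw [sum_inner, map_sum, h2, Finset.sum_congr rfl fun n _ => h1 n] at h3
  nlinarith [sq_nonneg ‖∑ n ∈ s, tensorMode (partialCoeff φ n) n - φ‖]

theorem summable_flowMode (t : ℝ) (φ : L2Cylinder) : Summable (flowMode t φ) := by
  have h := (orthogonalFamily_tensorMode.summable_iff_norm_sq_summable
    (fun n => (𝓕⁻ (mulFlowSymbol t n (cylinderFourier φ n)) : L2Line))).2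
  refine h ?_
  simp only [norm_fourierInv_mulFlowSymbol]
  exact summable_of_sum_le (fun _ => sq_nonneg _) (sum_sq_norm_partialCoeff_le φ)

/-- The hyperbolic Schrödinger flow `e^{it(∂₁² - ∂₂²)} φ` on `L²(ℝ × 𝕋)`: the sum over all
periodic frequencies, convergent in `L²(ℝ × 𝕋)` by orthogonality. -/
noncomputable def hyperbolicFlow (t : ℝ) (φ : L2Cylinder) : L2Cylinder :=
  ∑' n : ℤ, flowMode t φ n

theorem inner_partialCoeff_hyperbolicFlow (t : ℝ) (φ : L2Cylinder) (g : L2Line) (n : ℤ) :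
    inner ℂ g (partialCoeff (hyperbolicFlow t φ) n) =
      inner ℂ g (𝓕⁻ (mulFlowSymbol t n (cylinderFourier φ n))) := by
  rw [← partialCoeff_tensorMode_inner]
  have h := ((innerSL ℂ (tensorMode g n)).hasSum (summable_flowMode t φ).hasSum)
  have h' := h.unique (hasSum_single n ?_)
  · simpa [flowMode, inner_tensorMode, hyperbolicFlow] using h'
  · intro m hm; simp [flowMode, inner_tensorMode, Ne.symm hm]

/-- The flow is the Fourier multiplier with symbol `exp (-4π² i t (ξ₁² - n²))`. -/
theorem cylinderFourier_hyperbolicFlow (t : ℝ) (φ : L2Cylinder) (n : ℤ) :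
    cylinderFourier (hyperbolicFlow t φ) n = mulFlowSymbol t n (cylinderFourier φ n) := by
  rw [cylinderFourier, ext_inner_left ℂ (fun g => inner_partialCoeff_hyperbolicFlow t φ g n), fourier_fourierInv_eq]

/-- The measure of the space-time region `[0, 1] × ℝ × 𝕋`. -/
noncomputable def spaceTimeMeasure : Measure (ℝ × Cylinder) :=
  ((volume : Measure ℝ).restrict (Set.Icc 0 1)).prod (volume : Measure Cylinder)

/-- `u` is the flow `(t, x) ↦ (e^{it(∂₁² - ∂₂²)} φ)(x)`, as a measurable function on
`[0, 1] × ℝ × 𝕋`. This determines `u` up to equality almost everywhere. -/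
def RepresentsFlow (φ : L2Cylinder) (u : ℝ × Cylinder → ℂ) : Prop :=
  AEStronglyMeasurable u spaceTimeMeasure ∧
    ∀ᵐ t ∂((volume : Measure ℝ).restrict (Set.Icc 0 1)),
      (fun x => u (t, x)) =ᵐ[volume] hyperbolicFlow t φ

/-! Take a solution `u` whose Fourier transform `h` is continuous with compact support. By
Plancherel in `x`, the fourth power of the `L⁴` norm of `u(t)` is the squared `L²` norm of the
Fourier transform of `u²`, a self-convolution on `ℝ × ℤ`. Replacing the indicator of `[0,1]` by the
larger weight `e · exp(-t²)` and integrating in time bounds the space-time norm by `∫ |h(p) h(p-w)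
h(p-z) h(p-w-z)| exp(-r(w,z)²)`, up to a constant, with `r(w,z) = w₁z₁ - w₂z₂`. The phase defect of
a parallelogram depends only on its sides, because the symbol is quadratic.

It remains to bound this form by a constant times `‖h‖₂⁴`
(`exists_parallelogramForm_gaussKernel_le`). Cauchy-Schwarz on two pairs of vertices reduces it to a
Schur test: with one difference of vertices held fixed, the kernel must have bounded integral in
`w`. Up to exchanging `w` and `z` there are three regimes.

Flat, `w₂ = 0`: here `r = w₁z₁`, and for fixed `z` the integral is of size `1/|z₁|`, which is
unbounded. Opposite vertices are paired instead, which fixes `w ± z`; then `r` is a quadratic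
polynomial in `w₁` with leading coefficient `±1`, and the integral is uniformly bounded
(`lintegral_flat_le`).

Transversal, `0 < |w₂| ≤ 2|z₁|`: each row contributes at most `√π/|z₁|`, and there are at most
`4|z₁|` rows (`lintegral_transversal_le`).

Steep, the rest: `w₂z₂` dominates `w₁z₁`, so the kernel is `O((w₂z₂)⁻²)` on a `w₁`-interval of
length `|z₂|`, which is summable over `w₂ ≠ 0` since `|z₂| ≥ 1` (`lintegral_steep_le`).

General data follow by density: an almost everywhere convergent subsequence and Fatou's lemma carry
the estimate to the limit. -/

/-! ### Frequency space and its Haar measure. -/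

/-- The frequency space `ℝ × ℤ`, dual to the cylinder `ℝ × 𝕋`. -/
abbrev Freq : Type := ℝ × ℤ

/-- The Haar measure on the frequency space. -/
noncomputable abbrev freqMeasure : Measure Freq := (volume : Measure ℝ).prod Measure.count

/-- Makes `freqMeasure` a Haar measure, hence invariant under the shifts and reflections used below
and finite on compact sets. -/
instance isAddHaarMeasure_count_int : (Measure.count : Measure ℤ).IsAddHaarMeasure where
  lt_top_of_isCompact K hK :=
    Measure.count_apply_lt_top.2 (isCompact_iff_finite.1 hK)
  open_pos U _ hU := by rw [Ne, Measure.count_eq_zero_iff]; exact hU.ne_empty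

theorem lintegral_freq {f : Freq → ℝ≥0∞} (hf : AEMeasurable f freqMeasure) :
    ∫⁻ p, f p ∂freqMeasure = ∑' n : ℤ, ∫⁻ ξ : ℝ, f (ξ, n) := by
  rw [lintegral_prod_symm _ hf, lintegral_count]

/-! ### Schur tests for the parallelogram form. -/

section Pairings

variable {F : Freq → ℝ≥0∞} {K : Freq → Freq → ℝ≥0∞}

/-- The nonnegative quadrilinear form over parallelograms `p, p - w, p - z, p - w - z` with
weight `K w z`. -/
noncomputable def parallelogramForm (F : Freq → ℝ≥0∞) (K : Freq → Freq → ℝ≥0∞) : ℝ≥0∞ :=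
  ∫⁻ p, ∫⁻ w, ∫⁻ z, F p * F (p - w) * F (p - z) * F (p - w - z) * K w z
    ∂freqMeasure ∂freqMeasure ∂freqMeasure

theorem ENNReal.mul_le_sq_add_sq (x y : ℝ≥0∞) : x * y ≤ x ^ 2 + y ^ 2 := by
  rcases le_total x y with h | h
  · calc x * y ≤ y * y := by gcongr
      _ ≤ _ := by rw [← sq]; exact le_add_self
  · calc x * y ≤ x * x := by gcongr
      _ ≤ _ := by rw [← sq]; exact le_self_add

theorem lintegral_mul_shift (hF : Measurable F) :
    ∫⁻ p, ∫⁻ s, F p ^ 2 * F (p - s) ^ 2 ∂freqMeasure ∂freqMeasure =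
      (∫⁻ p, F p ^ 2 ∂freqMeasure) ^ 2 := by
  have h : ∀ p, ∫⁻ s, F p ^ 2 * F (p - s) ^ 2 ∂freqMeasure =
      F p ^ 2 * ∫⁻ s, F s ^ 2 ∂freqMeasure := fun p => by
    rw [lintegral_const_mul _ (by fun_prop),
      lintegral_sub_left_eq_self (fun s => F s ^ 2) p]
  simp_rw [h]
  rw [lintegral_mul_const _ (by fun_prop), sq (∫⁻ p, F p ^ 2 ∂freqMeasure)]

/-- The common core of the Schur tests: once `p` and the difference `s` are held fixed, `w` occurs
only in the weight and can be integrated first. -/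
theorem lintegral_shift_weight_le {L : Freq → Freq → ℝ≥0∞} (hF : Measurable F)
    (hL : Measurable (Function.uncurry L)) {C : ℝ≥0∞}
    (hC : ∀ s, ∫⁻ w, L w s ∂freqMeasure ≤ C) :
    ∫⁻ p, ∫⁻ w, ∫⁻ s, F p ^ 2 * F (p - s) ^ 2 * L w s ∂freqMeasure ∂freqMeasure ∂freqMeasure ≤
      C * (∫⁻ p, F p ^ 2 ∂freqMeasure) ^ 2 := by
  rw [← lintegral_mul_shift hF, mul_comm, ← lintegral_mul_const _ (by fun_prop)]
  refine lintegral_mono fun p => ?_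
  rw [lintegral_lintegral_swap (by fun_prop), ← lintegral_mul_const _ (by fun_prop)]
  refine lintegral_mono fun s => ?_
  rw [lintegral_const_mul _ (by fun_prop)]
  gcongr
  exact hC s

theorem parallelogramForm_swap (hF : Measurable F) (hK : Measurable (Function.uncurry K)) :
    parallelogramForm F (fun w z => K z w) = parallelogramForm F K := by
  unfold parallelogramForm
  refine lintegral_congr fun p => ?_
  rw [lintegral_lintegral_swap (by fun_prop)]
  refine lintegral_congr fun w => lintegral_congr fun z => ?_
  rw [sub_right_comm p z w]
  ring

theorem parallelogramForm_add {K' : Freq → Freq → ℝ≥0∞} (hF : Measurable F)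
    (hK : Measurable (Function.uncurry K)) (_ : Measurable (Function.uncurry K')) :
    parallelogramForm F (fun w z => K w z + K' w z) =
      parallelogramForm F K + parallelogramForm F K' := by
  unfold parallelogramForm
  simp_rw [mul_add]
  rw [← lintegral_add_left (by fun_prop)]
  refine lintegral_congr fun p => ?_
  rw [← lintegral_add_left (by fun_prop)]
  refine lintegral_congr fun w => ?_
  rw [← lintegral_add_left (by fun_prop)]

theorem parallelogramForm_mono {K' : Freq → Freq → ℝ≥0∞} (h : ∀ w z, K w z ≤ K' w z) :
    parallelogramForm F K ≤ parallelogramForm F K' := by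
  unfold parallelogramForm
  gcongr
  exact h _ _

/-- Pairing the vertices that differ by `z`. -/
theorem parallelogramForm_le_of_side (hF : Measurable F) (hK : Measurable (Function.uncurry K))
    {C : ℝ≥0∞} (hC : ∀ z, ∫⁻ w, K w z ∂freqMeasure ≤ C) :
    parallelogramForm F K ≤ 2 * C * (∫⁻ p, F p ^ 2 ∂freqMeasure) ^ 2 := by
  have h1 := lintegral_shift_weight_le hF hK hC
  have h2 : ∫⁻ p, ∫⁻ w, ∫⁻ z, F (p - w) ^ 2 * F (p - w - z) ^ 2 * K w z
      ∂freqMeasure ∂freqMeasure ∂freqMeasure =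
      ∫⁻ p, ∫⁻ w, ∫⁻ z, F p ^ 2 * F (p - z) ^ 2 * K w z
      ∂freqMeasure ∂freqMeasure ∂freqMeasure := by
    -- The second side parallel to `z` is the first one translated by `w`.
    rw [lintegral_lintegral_swap (by fun_prop),
      lintegral_lintegral_swap (f := fun p w => ∫⁻ z, F p ^ 2 * F (p - z) ^ 2 * K w z
        ∂freqMeasure) (by fun_prop)]
    exact lintegral_congr fun w => lintegral_sub_right_eq_self
      (fun p => ∫⁻ z, F p ^ 2 * F (p - z) ^ 2 * K w z ∂freqMeasure) w
  calc parallelogramForm F K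
      ≤ ∫⁻ p, ∫⁻ w, ∫⁻ z, (F p ^ 2 * F (p - z) ^ 2 * K w z +
          F (p - w) ^ 2 * F (p - w - z) ^ 2 * K w z)
          ∂freqMeasure ∂freqMeasure ∂freqMeasure := by
        unfold parallelogramForm
        gcongr with p w z
        calc F p * F (p - w) * F (p - z) * F (p - w - z) * K w z
            = (F p * F (p - z)) * (F (p - w) * F (p - w - z)) * K w z := by ring
          _ ≤ ((F p * F (p - z)) ^ 2 + (F (p - w) * F (p - w - z)) ^ 2) * K w z := by
            gcongr; exact ENNReal.mul_le_sq_add_sq _ _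
          _ = _ := by ring
    _ = ∫⁻ p, ∫⁻ w, ∫⁻ z, F p ^ 2 * F (p - z) ^ 2 * K w z
          ∂freqMeasure ∂freqMeasure ∂freqMeasure +
        ∫⁻ p, ∫⁻ w, ∫⁻ z, F (p - w) ^ 2 * F (p - w - z) ^ 2 * K w z
          ∂freqMeasure ∂freqMeasure ∂freqMeasure := by
        rw [← lintegral_add_left (by fun_prop)]
        refine lintegral_congr fun p => ?_
        rw [← lintegral_add_left (by fun_prop)]
        refine lintegral_congr fun w => ?_
        rw [← lintegral_add_left (by fun_prop)]
    _ ≤ 2 * C * (∫⁻ p, F p ^ 2 ∂freqMeasure) ^ 2 := by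
        rw [h2, ← two_mul, mul_assoc]
        gcongr

/-- Pairing opposite vertices. -/
theorem parallelogramForm_le_of_diagonal (hF : Measurable F)
    (hK : Measurable (Function.uncurry K)) {C : ℝ≥0∞}
    (hC : ∀ s, ∫⁻ w, K w (s - w) ∂freqMeasure ≤ C)
    (hC' : ∀ s, ∫⁻ w, K w (s + w) ∂freqMeasure ≤ C) :
    parallelogramForm F K ≤ 2 * C * (∫⁻ p, F p ^ 2 ∂freqMeasure) ^ 2 := by
  have hK1 : Measurable (Function.uncurry fun w s => K w (s - w)) :=
    hK.comp (measurable_fst.prodMk (measurable_snd.sub measurable_fst))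
  have hK2 : Measurable (Function.uncurry fun w s => K w (s + w)) :=
    hK.comp (measurable_fst.prodMk (measurable_snd.add measurable_fst))
  -- The vertices `p` and `p - w - z` differ by `s = w + z`, so `z = s - w`.
  have h1 : ∫⁻ p, ∫⁻ w, ∫⁻ z, F p ^ 2 * F (p - w - z) ^ 2 * K w z
      ∂freqMeasure ∂freqMeasure ∂freqMeasure ≤ C * (∫⁻ p, F p ^ 2 ∂freqMeasure) ^ 2 := by
    refine le_of_eq_of_le ?_ (lintegral_shift_weight_le hF hK1 hC)
    refine lintegral_congr fun p => lintegral_congr fun w => ?_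
    rw [← lintegral_sub_right_eq_self _ w]
    refine lintegral_congr fun s => ?_
    rw [show p - w - (s - w) = p - s by abel]
  -- The other diagonal is `s = z - w`, so `z = s + w`; translating `p` by `w` brings the product to
  -- the standard shape.
  have h2 : ∫⁻ p, ∫⁻ w, ∫⁻ z, F (p - w) ^ 2 * F (p - z) ^ 2 * K w z
      ∂freqMeasure ∂freqMeasure ∂freqMeasure ≤ C * (∫⁻ p, F p ^ 2 ∂freqMeasure) ^ 2 := by
    refine le_of_eq_of_le ?_ (lintegral_shift_weight_le hF hK2 hC')
    rw [lintegral_lintegral_swap (by fun_prop),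
      lintegral_lintegral_swap (f := fun p w => ∫⁻ s, F p ^ 2 * F (p - s) ^ 2 * K w (s + w)
        ∂freqMeasure) (by fun_prop)]
    refine lintegral_congr fun w => ?_
    rw [← lintegral_sub_right_eq_self (fun p => ∫⁻ s, F p ^ 2 * F (p - s) ^ 2 * K w (s + w)
        ∂freqMeasure) w]
    refine lintegral_congr fun p => ?_
    rw [← lintegral_add_right_eq_self _ w]
    refine lintegral_congr fun s => ?_
    rw [show p - (s + w) = p - w - s by abel]
  calc parallelogramForm F K
      ≤ ∫⁻ p, ∫⁻ w, ∫⁻ z, (F p ^ 2 * F (p - w - z) ^ 2 * K w z +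
          F (p - w) ^ 2 * F (p - z) ^ 2 * K w z)
          ∂freqMeasure ∂freqMeasure ∂freqMeasure := by
        unfold parallelogramForm
        gcongr with p w z
        calc F p * F (p - w) * F (p - z) * F (p - w - z) * K w z
            = (F p * F (p - w - z)) * (F (p - w) * F (p - z)) * K w z := by ring
          _ ≤ ((F p * F (p - w - z)) ^ 2 + (F (p - w) * F (p - z)) ^ 2) * K w z := by
            gcongr; exact ENNReal.mul_le_sq_add_sq _ _
          _ = _ := by ring
    _ = ∫⁻ p, ∫⁻ w, ∫⁻ z, F p ^ 2 * F (p - w - z) ^ 2 * K w z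
          ∂freqMeasure ∂freqMeasure ∂freqMeasure +
        ∫⁻ p, ∫⁻ w, ∫⁻ z, F (p - w) ^ 2 * F (p - z) ^ 2 * K w z
          ∂freqMeasure ∂freqMeasure ∂freqMeasure := by
        rw [← lintegral_add_left (by fun_prop)]
        refine lintegral_congr fun p => ?_
        rw [← lintegral_add_left (by fun_prop)]
        refine lintegral_congr fun w => ?_
        rw [← lintegral_add_left (by fun_prop)]
    _ ≤ 2 * C * (∫⁻ p, F p ^ 2 ∂freqMeasure) ^ 2 := by
        rw [mul_assoc, two_mul]
        gcongr

end Pairings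

/-! ### The resonance kernel and its three regimes. -/

/-- The defect of resonance of the parallelogram with sides `w`, `z`. -/
def resonance (w z : Freq) : ℝ := w.1 * z.1 - w.2 * z.2

/-- A Gaussian weight in the defect of resonance. -/
noncomputable def gaussKernel (w z : Freq) : ℝ≥0∞ :=
  ENNReal.ofReal (Real.exp (-(resonance w z) ^ 2))

theorem measurable_resonance : Measurable (Function.uncurry resonance) := by
  unfold resonance Function.uncurry
  have h : Measurable (fun n : ℤ => (n : ℝ)) := measurable_from_top
  fun_prop

theorem measurable_gaussKernel : Measurable (Function.uncurry gaussKernel) := by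
  have := measurable_resonance
  unfold gaussKernel Function.uncurry at *
  fun_prop

theorem gaussKernel_swap (w z : Freq) : gaussKernel w z = gaussKernel z w := by
  unfold gaussKernel resonance
  ring_nf

theorem lintegral_gaussian {b : ℝ} (hb : 0 < b) :
    ∫⁻ x : ℝ, ENNReal.ofReal (Real.exp (-b * x ^ 2)) = ENNReal.ofReal (√(Real.pi / b)) := by
  rw [← integral_gaussian, ofReal_integral_eq_lintegral_ofReal (integrable_exp_neg_mul_sq hb)
    (Filter.Eventually.of_forall fun x => (Real.exp_pos _).le)]

theorem lintegral_gaussian_affine {a : ℝ} (ha : a ≠ 0) (b : ℝ) :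
    ∫⁻ x : ℝ, ENNReal.ofReal (Real.exp (-(x * a - b) ^ 2)) =
      ENNReal.ofReal (√Real.pi / |a|) := by
  have h : ∀ x : ℝ, -(x * a - b) ^ 2 = -(a ^ 2) * (x - b / a) ^ 2 := fun x => by
    field_simp
  simp_rw [h]
  rw [lintegral_sub_right_eq_self (fun x : ℝ => ENNReal.ofReal (Real.exp (-(a ^ 2) * x ^ 2))),
    lintegral_gaussian (by positivity), Real.sqrt_div Real.pi_nonneg, Real.sqrt_sq_eq_abs]

/-- If `m` is the smaller of `|x|` and `|y|`, then `(xy)² ≥ m⁴ ≥ m² - 1`, and the Gaussian in `m` is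
one of the two on the right. -/
theorem exp_neg_sq_mul_le (x y : ℝ) :
    Real.exp (-(x * y) ^ 2) ≤
      Real.exp 1 * (Real.exp (-1 * x ^ 2) + Real.exp (-1 * y ^ 2)) := by
  have key : ∀ x y : ℝ, |x| ≤ |y| → Real.exp (-(x * y) ^ 2) ≤
      Real.exp 1 * Real.exp (-1 * x ^ 2) := fun x y h => by
    rw [← Real.exp_add, Real.exp_le_exp]
    have h1 : x ^ 2 ≤ y ^ 2 := sq_le_sq.2 h
    nlinarith [mul_le_mul_of_nonneg_left h1 (sq_nonneg x), sq_nonneg (x ^ 2 - 1), sq_nonneg x]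
  rcases le_total |x| |y| with h | h
  · refine (key x y h).trans ?_
    gcongr
    exact le_add_of_nonneg_right (Real.exp_pos _).le
  · rw [mul_comm x y]
    refine (key y x h).trans ?_
    gcongr
    exact le_add_of_nonneg_left (Real.exp_pos _).le

/-- The mass sits near the two zeros `0` and `σ`; the bound stays uniform as they merge. -/
theorem lintegral_gaussian_quadratic_le (σ : ℝ) :
    ∫⁻ x : ℝ, ENNReal.ofReal (Real.exp (-(x * (σ - x)) ^ 2)) ≤
      ENNReal.ofReal (Real.exp 1) * (2 * ENNReal.ofReal (√Real.pi)) := by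
  have h0 := lintegral_gaussian one_pos
  rw [div_one] at h0
  calc ∫⁻ x : ℝ, ENNReal.ofReal (Real.exp (-(x * (σ - x)) ^ 2))
      ≤ ∫⁻ x : ℝ, ENNReal.ofReal (Real.exp 1) * (ENNReal.ofReal (Real.exp (-1 * x ^ 2)) +
          ENNReal.ofReal (Real.exp (-1 * (σ - x) ^ 2))) := by
        refine lintegral_mono fun x => ?_
        rw [← ENNReal.ofReal_add (by positivity) (by positivity),
          ← ENNReal.ofReal_mul (by positivity)]
        exact ENNReal.ofReal_le_ofReal (exp_neg_sq_mul_le _ _)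
    _ = _ := by
        rw [lintegral_const_mul _ (by fun_prop), lintegral_add_left (by fun_prop), h0,
          lintegral_sub_left_eq_self
            (fun x : ℝ => ENNReal.ofReal (Real.exp (-1 * x ^ 2))) σ, h0, two_mul]

open Classical in
/-- `K` restricted to pairs of sides satisfying `P`. -/
noncomputable def restrictKernel (P : Freq → Freq → Prop) (w z : Freq) : ℝ≥0∞ :=
  if P w z then gaussKernel w z else 0

theorem measurable_restrictKernel {P : Freq → Freq → Prop}
    (hP : MeasurableSet {q : Freq × Freq | P q.1 q.2}) :
    Measurable (Function.uncurry (restrictKernel P)) := by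
  classical
  exact Measurable.ite hP measurable_gaussKernel measurable_const

theorem measurable_restrictKernel_left {P : Freq → Freq → Prop}
    (hP : MeasurableSet {q : Freq × Freq | P q.1 q.2}) (z : Freq) :
    Measurable (fun w => restrictKernel P w z) :=
  (measurable_restrictKernel hP).of_uncurry_right

/-- The side `w` is horizontal. -/
def IsFlat (w _z : Freq) : Prop := w.2 = 0

/-- The side `z` is not too steep compared with the height of `w`. -/
def IsTransversal (w z : Freq) : Prop := w.2 ≠ 0 ∧ |(w.2 : ℝ)| ≤ 2 * |z.1|

/-- Neither side is horizontal, and each is short horizontally compared with the height of the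
other one. -/
def IsSteep (w z : Freq) : Prop :=
  w.2 ≠ 0 ∧ z.2 ≠ 0 ∧ 2 * |z.1| < |(w.2 : ℝ)| ∧ 2 * |w.1| < |(z.2 : ℝ)|

theorem measurableSet_isFlat : MeasurableSet {q : Freq × Freq | IsFlat q.1 q.2} := by
  unfold IsFlat
  exact measurable_snd.comp measurable_fst (measurableSet_singleton 0)

theorem measurableSet_isTransversal :
    MeasurableSet {q : Freq × Freq | IsTransversal q.1 q.2} := by
  unfold IsTransversal
  have h : Measurable (fun n : ℤ => (n : ℝ)) := measurable_from_top
  exact (measurable_snd.comp measurable_fst (measurableSet_singleton 0)).compl.inter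
    (measurableSet_le (f := fun q : Freq × Freq => |(q.1.2 : ℝ)|)
      (g := fun q => 2 * |q.2.1|) (by fun_prop) (by fun_prop))

theorem measurableSet_isSteep : MeasurableSet {q : Freq × Freq | IsSteep q.1 q.2} := by
  unfold IsSteep
  have h : Measurable (fun n : ℤ => (n : ℝ)) := measurable_from_top
  exact (measurable_snd.comp measurable_fst (measurableSet_singleton 0)).compl.inter
    ((measurable_snd.comp measurable_snd (measurableSet_singleton 0)).compl.inter
    ((measurableSet_lt (f := fun q : Freq × Freq => 2 * |q.2.1|)
      (g := fun q => |(q.1.2 : ℝ)|) (by fun_prop) (by fun_prop)).inter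
    (measurableSet_lt (f := fun q : Freq × Freq => 2 * |q.1.1|)
      (g := fun q => |(q.2.2 : ℝ)|) (by fun_prop) (by fun_prop))))

/-- When neither side is flat and neither order is transversal, the failed inequalities are exactly
the steep condition. The exchanged terms cost nothing because the form is symmetric in `w` and `z`.
-/
theorem gaussKernel_le (w z : Freq) :
    gaussKernel w z ≤ ((restrictKernel IsFlat w z + restrictKernel IsTransversal w z) +
      (restrictKernel IsFlat z w + restrictKernel IsTransversal z w)) +
      restrictKernel IsSteep w z := by
  classical
  have cover : IsFlat w z ∨ IsTransversal w z ∨ IsFlat z w ∨ IsTransversal z w ∨ IsSteep w z := by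
    unfold IsFlat IsTransversal IsSteep
    by_contra! h
    obtain ⟨h1, h2, h3, h4, h5⟩ := h
    exact absurd (h4 h3) (not_lt.2 (h5 h1 h3 (h2 h1)))
  unfold restrictKernel
  rw [gaussKernel_swap z w]
  rcases cover with h | h | h | h | h <;> rw [if_pos h]
  · exact le_self_add.trans (le_self_add.trans le_self_add)
  · exact le_add_self.trans (le_self_add.trans le_self_add)
  · exact le_self_add.trans (le_add_self.trans le_self_add)
  · exact le_add_self.trans (le_add_self.trans le_self_add)
  · exact le_add_self

/-- The sign `ε` treats both diagonals at once: `z = s - w` for `ε = 1`, `σ = s₁`, and `z = s + w`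
for `ε = -1`, `σ = -s₁`. -/
theorem lintegral_flat_le {z : Freq → Freq} (hz : Measurable z) (ε σ : ℝ)
    (hε : ε ^ 2 = 1) (h : ∀ x : ℝ, (z (x, 0)).1 = ε * (σ - x)) :
    ∫⁻ w, restrictKernel IsFlat w (z w) ∂freqMeasure ≤
      ENNReal.ofReal (Real.exp 1) * (2 * ENNReal.ofReal (√Real.pi)) := by
  have hm : Measurable fun w => restrictKernel IsFlat w (z w) :=
    (measurable_restrictKernel measurableSet_isFlat).comp (measurable_id.prodMk hz)
  rw [lintegral_freq hm.aemeasurable, tsum_eq_single 0]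
  · refine le_of_eq_of_le (lintegral_congr fun x => ?_) (lintegral_gaussian_quadratic_le σ)
    unfold restrictKernel IsFlat
    rw [if_pos rfl, gaussKernel, resonance, h]
    congr 2
    simp only [Int.cast_zero, zero_mul, sub_zero, mul_pow, hε]
    ring
  · intro n hn
    simp [restrictKernel, IsFlat, hn]

/-- On each row `n` the resonance is affine in `w₁` with slope `z₁`, which gives `√π/|z₁|`; the
number of admissible rows is proportional to `|z₁|` and compensates exactly. -/
theorem lintegral_transversal_le (z : Freq) :
    ∫⁻ w, restrictKernel IsTransversal w z ∂freqMeasure ≤ ENNReal.ofReal (4 * √Real.pi) := by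
  rw [lintegral_freq (measurable_restrictKernel_left measurableSet_isTransversal z).aemeasurable]
  rcases eq_or_ne z.1 0 with h0 | h0
  · have : ∀ (n : ℤ) (x : ℝ), restrictKernel IsTransversal (x, n) z = 0 := fun n x => by
      unfold restrictKernel IsTransversal
      rw [if_neg]
      rintro ⟨h1, h2⟩
      rw [h0, abs_zero, mul_zero, abs_nonpos_iff] at h2
      exact h1 (by exact_mod_cast h2)
    simp [this]
  · have hpos : 0 < |z.1| := abs_pos.2 h0
    set M : ℤ := ⌊2 * |z.1|⌋ with hM
    have hM0 : 0 ≤ M := Int.floor_nonneg.2 (by positivity)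
    have hMle : (M : ℝ) ≤ 2 * |z.1| := Int.floor_le _
    -- Without the row `0` the count is `2M` instead of `2M + 1`. The extra row would destroy the
    -- bound as `z₁ → 0`, which is why the flat case is treated apart.
    set S : Finset ℤ := (Finset.Icc (-M) M).erase 0 with hS
    have hcard : (S.card : ℝ) ≤ 4 * |z.1| := by
      have : (S.card : ℤ) = 2 * M := by
        rw [hS, Finset.card_erase_of_mem (by simp [hM0]), Int.card_Icc]
        omega
      have h2 : (S.card : ℝ) = 2 * M := by exact_mod_cast this
      rw [h2]; linarith
    rw [tsum_eq_sum (s := S)]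
    · calc ∑ n ∈ S, ∫⁻ x : ℝ, restrictKernel IsTransversal (x, n) z
          ≤ ∑ n ∈ S, ENNReal.ofReal (√Real.pi / |z.1|) := by
            refine Finset.sum_le_sum fun n _ => ?_
            rw [← lintegral_gaussian_affine h0 (n * z.2)]
            refine lintegral_mono fun x => ?_
            unfold restrictKernel
            split_ifs
            · exact le_rfl
            · exact zero_le
        _ = ENNReal.ofReal (S.card * (√Real.pi / |z.1|)) := by
            rw [Finset.sum_const, nsmul_eq_mul, ENNReal.ofReal_mul (by positivity),
              ENNReal.ofReal_natCast]
        _ ≤ _ := by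
            refine ENNReal.ofReal_le_ofReal ?_
            calc S.card * (√Real.pi / |z.1|) ≤ 4 * |z.1| * (√Real.pi / |z.1|) := by gcongr
              _ = _ := by field_simp
    · intro n hn
      have : ∀ x : ℝ, restrictKernel IsTransversal (x, n) z = 0 := fun x => by
        unfold restrictKernel IsTransversal
        rw [if_neg]
        rintro ⟨h1, h2⟩
        refine hn (Finset.mem_erase.2 ⟨h1, Finset.mem_Icc.2 (abs_le.1 ?_)⟩)
        exact Int.le_floor.2 (by push_cast; exact h2)
      simp [this]

/-- Steepness gives `|x z₁| ≤ |n z₂|/4`, so the resonance is at least `3/4 · |n z₂|` in absolute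
value; then `exp(-y) ≤ 1/y` with `y = (n z₂)²/2`. -/
theorem restrictKernel_steep_le (z : Freq) (n : ℤ) (x : ℝ) :
    restrictKernel IsSteep (x, n) z ≤
      (Set.Icc (-(|(z.2 : ℝ)| / 2)) (|(z.2 : ℝ)| / 2)).indicator
        (fun _ => ENNReal.ofReal (2 / ((z.2 : ℝ) ^ 2 * (n : ℝ) ^ 2))) x := by
  classical
  unfold restrictKernel
  split_ifs with h
  · obtain ⟨h1, h2, h3, h4⟩ := h
    simp only at h1 h3 h4
    rw [Set.indicator_of_mem (by rw [Set.mem_Icc, ← abs_le]; linarith)]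
    refine ENNReal.ofReal_le_ofReal ?_
    have hn : 0 < (n : ℝ) ^ 2 := by positivity
    have hz : 0 < (z.2 : ℝ) ^ 2 := by positivity
    have hxz : |x * z.1| ≤ |(n : ℝ) * z.2| / 4 := by
      rw [abs_mul, abs_mul]
      nlinarith [mul_le_mul h3.le h4.le (by positivity) (by positivity)]
    have hR : (n * z.2 : ℝ) ^ 2 / 2 ≤ (resonance (x, n) z) ^ 2 := by
      unfold resonance
      have := abs_sub_abs_le_abs_sub ((n : ℝ) * z.2) (x * z.1)
      rw [abs_sub_comm] at this
      have h5 : 3 / 4 * |(n : ℝ) * z.2| ≤ |x * z.1 - n * z.2| := by linarith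
      rw [← sq_abs (x * z.1 - n * z.2), ← sq_abs (n * z.2 : ℝ)]
      nlinarith [abs_nonneg ((n : ℝ) * z.2)]
    have hpos : 0 < (n * z.2 : ℝ) ^ 2 / 2 := by rw [mul_pow]; positivity
    calc Real.exp (-(resonance (x, n) z) ^ 2)
        ≤ Real.exp (-((n * z.2 : ℝ) ^ 2 / 2)) := Real.exp_le_exp.2 (by linarith)
      _ ≤ ((n * z.2 : ℝ) ^ 2 / 2)⁻¹ := by
        rw [Real.exp_neg]
        exact inv_anti₀ hpos (by linarith [Real.add_one_le_exp ((n * z.2 : ℝ) ^ 2 / 2)])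
      _ = _ := by rw [inv_div, mul_pow, mul_comm ((n : ℝ) ^ 2)]
  · exact zero_le

/-- An interval of length `|z₂|` times `2/(z₂² n²)` is at most `2/n²`, because a nonzero integer has
`|z₂| ≥ 1`. -/
theorem lintegral_steep_le (z : Freq) :
    ∫⁻ w, restrictKernel IsSteep w z ∂freqMeasure ≤
      ∑' n : ℤ, ENNReal.ofReal (2 * (1 / (n : ℝ) ^ 2)) := by
  rw [lintegral_freq (measurable_restrictKernel_left measurableSet_isSteep z).aemeasurable]
  refine ENNReal.tsum_le_tsum fun n => ?_
  rcases eq_or_ne z.2 0 with h0 | h0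
  · simp [restrictKernel, IsSteep, h0]
  refine (lintegral_mono fun x => restrictKernel_steep_le z n x).trans ?_
  rw [lintegral_indicator_const measurableSet_Icc, Real.volume_Icc,
    ← ENNReal.ofReal_mul (by positivity)]
  refine ENNReal.ofReal_le_ofReal ?_
  have h1 : (1 : ℝ) ≤ |(z.2 : ℝ)| := by exact_mod_cast Int.one_le_abs h0
  rw [← sq_abs (z.2 : ℝ)]
  -- At `n = 0` both sides vanish, by the convention that division by zero gives zero.
  rcases eq_or_ne n 0 with hn | hn
  · simp [hn]
  have hn' : 0 < (n : ℝ) ^ 2 := by positivity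
  rw [div_mul_eq_mul_div, mul_one_div, div_le_div_iff₀ (by positivity) hn']
  nlinarith [mul_le_mul_of_nonneg_right
    (mul_le_mul_of_nonneg_right h1 (abs_nonneg (z.2 : ℝ))) hn'.le]

theorem tsum_inv_sq_lt_top : ∑' n : ℤ, ENNReal.ofReal (2 * (1 / (n : ℝ) ^ 2)) < ∞ := by
  have h : Summable fun n : ℤ => 2 * (1 / (n : ℝ) ^ 2) :=
    (Real.summable_one_div_int_pow.2 one_lt_two).mul_left 2
  exact h.tsum_ofReal_lt_top

/-- The quadrilinear estimate over approximately resonant parallelograms. -/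
theorem exists_parallelogramForm_gaussKernel_le :
    ∃ C : ℝ≥0∞, C ≠ ∞ ∧ ∀ F : Freq → ℝ≥0∞, Measurable F →
      parallelogramForm F gaussKernel ≤ C * (∫⁻ p, F p ^ 2 ∂freqMeasure) ^ 2 := by
  set C₀ := ENNReal.ofReal (Real.exp 1) * (2 * ENNReal.ofReal (√Real.pi))
  set C₁ := ENNReal.ofReal (4 * √Real.pi)
  set C₂ := ∑' n : ℤ, ENNReal.ofReal (2 * (1 / (n : ℝ) ^ 2))
  have h2 : C₂ ≠ ∞ := tsum_inv_sq_lt_top.ne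
  refine ⟨2 * C₀ + 2 * C₁ + (2 * C₀ + 2 * C₁) + 2 * C₂, by finiteness, fun F hF => ?_⟩
  have m0 := measurable_restrictKernel measurableSet_isFlat
  have m1 := measurable_restrictKernel measurableSet_isTransversal
  have m2 := measurable_restrictKernel measurableSet_isSteep
  have m0' : Measurable (Function.uncurry fun w z => restrictKernel IsFlat z w) :=
    m0.comp measurable_swap
  have m1' : Measurable (Function.uncurry fun w z => restrictKernel IsTransversal z w) :=
    m1.comp measurable_swap
  -- Only the flat part needs the diagonals; the side pairing suffices for the other two.
  have b0 : parallelogramForm F (restrictKernel IsFlat) ≤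
      2 * C₀ * (∫⁻ p, F p ^ 2 ∂freqMeasure) ^ 2 := by
    refine parallelogramForm_le_of_diagonal hF m0 (fun s => ?_) (fun s => ?_)
    · exact lintegral_flat_le (by fun_prop) 1 s.1 (by norm_num) (fun x => by simp)
    · exact lintegral_flat_le (by fun_prop) (-1) (-s.1) (by norm_num)
        (fun x => by simp [add_comm])
  have b1 := parallelogramForm_le_of_side hF m1 lintegral_transversal_le
  have b2 := parallelogramForm_le_of_side hF m2 lintegral_steep_le
  refine (parallelogramForm_mono gaussKernel_le).trans ?_
  have m3 : Measurable (Function.uncurry fun w z =>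
      restrictKernel IsFlat w z + restrictKernel IsTransversal w z) := m0.add m1
  have m3' : Measurable (Function.uncurry fun w z =>
      restrictKernel IsFlat z w + restrictKernel IsTransversal z w) := m0'.add m1'
  have m4 : Measurable (Function.uncurry fun w z =>
      restrictKernel IsFlat w z + restrictKernel IsTransversal w z +
        (restrictKernel IsFlat z w + restrictKernel IsTransversal z w)) := m3.add m3'
  rw [parallelogramForm_add hF m4 m2, parallelogramForm_add hF m3 m3',
    parallelogramForm_add hF m0 m1,
    parallelogramForm_add hF m0' m1', parallelogramForm_swap hF m0, parallelogramForm_swap hF m1]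
  simp only [add_mul]
  gcongr

/-! ### Fourier synthesis and Plancherel on the cylinder. -/

/-- The multiplication formula, which identifies the distributional inverse transform with the
integral one. -/
theorem integral_smul_fourierInv {f : ℝ → ℂ} (hf : Integrable f) (g : SchwartzMap ℝ ℂ) :
    ∫ x, 𝓕⁻ g x • f x = ∫ x, g x • 𝓕⁻ f x := by
  have h := VectorFourier.integral_fourierIntegral_smul_eq_flip (L := -innerₗ ℝ)
    Real.continuous_fourierChar continuous_inner.neg (g.integrable (μ := volume)) hf
  have e : (-innerₗ ℝ : ℝ →ₗ[ℝ] ℝ →ₗ[ℝ] ℝ).flip = -innerₗ ℝ := by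
    ext; simp
  rw [e] at h
  rw [SchwartzMap.fourierInv_coe]
  exact h

theorem continuous_fourierInv {f : ℝ → ℂ} (hf : Integrable f) : Continuous (𝓕⁻ f) :=
  VectorFourier.fourierIntegral_continuous (L := -innerₗ ℝ)
    Real.continuous_fourierChar continuous_inner.neg hf

/-- On `L¹ ∩ L²` the inverse Fourier transform of `L²` is given by the integral. -/
theorem coeFn_fourierInv_toLp {f : ℝ → ℂ} (hf : Integrable f) (hf2 : MemLp f 2 volume) :
    (𝓕⁻ (hf2.toLp f) : L2Line) =ᵐ[volume] 𝓕⁻ f := by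
  -- Both sides are locally integrable, so it is enough to pair them with smooth compactly supported
  -- functions, on which the `L²` transform acts as that of tempered distributions.
  refine ae_eq_of_integral_contDiff_smul_eq ?_
    (continuous_fourierInv hf).locallyIntegrable fun g hg hgs => ?_
  · exact (Lp.memLp _).locallyIntegrable (by norm_num)
  have hgs' : HasCompactSupport fun x => (g x : ℂ) := hgs.comp_left Complex.ofReal_zero
  set G : SchwartzMap ℝ ℂ := hgs'.toSchwartzMap (Complex.ofRealCLM.contDiff.comp hg)
  have h := congrArg (fun T => T G) (Lp.fourierInv_toTemperedDistribution_eq (hf2.toLp f))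
  simp only [TemperedDistribution.fourierInv_apply, Lp.toTemperedDistribution_apply] at h
  have h1 : ∫ x, (𝓕⁻ G) x • (hf2.toLp f) x = ∫ x, G x • 𝓕⁻ f x := by
    rw [← integral_smul_fourierInv hf]
    refine integral_congr_ae ?_
    filter_upwards [hf2.coeFn_toLp] with x hx
    rw [hx]
  exact h.symm.trans h1

/-- The character of the cylinder with frequency `p`. -/
noncomputable def freqChar (p : Freq) (x : Cylinder) : ℂ :=
  Complex.exp ((2 * Real.pi * (p.1 * x.1) : ℝ) * Complex.I) * fourier p.2 x.2

theorem norm_freqChar (p : Freq) (x : Cylinder) : ‖freqChar p x‖ = 1 := by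
  rw [freqChar, norm_mul, norm_fourier_apply, mul_one, Complex.norm_exp_ofReal_mul_I]

theorem freqChar_add (p q : Freq) (x : Cylinder) :
    freqChar (p + q) x = freqChar p x * freqChar q x := by
  unfold freqChar
  rw [Prod.snd_add, Prod.fst_add, fourier_add,
    mul_mul_mul_comm (Complex.exp _) _ (Complex.exp _), ← Complex.exp_add]
  congr 2
  push_cast
  ring

theorem continuous_freqChar_left (x : Cylinder) : Continuous fun p => freqChar p x := by
  have h : Continuous fun n : ℤ => (fourier n x.2 : ℂ) := continuous_of_discreteTopology
  have h2 : Continuous fun p : Freq => (fourier p.2 x.2 : ℂ) := h.comp continuous_snd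
  unfold freqChar
  fun_prop

theorem continuous_freqChar_right (p : Freq) : Continuous fun x => freqChar p x := by
  have h2 : Continuous fun x : Cylinder => (fourier p.2 x.2 : ℂ) :=
    (fourier p.2).continuous.comp continuous_snd
  unfold freqChar
  fun_prop

/-- The function on the cylinder with Fourier transform `h`. -/
noncomputable def freqSynth (h : Freq → ℂ) (x : Cylinder) : ℂ :=
  ∫ p, freqChar p x * h p ∂freqMeasure

section Slices

variable {h : Freq → ℂ}

theorem continuous_slice (hc : Continuous h) (n : ℤ) : Continuous fun ξ => h (ξ, n) := by
  fun_prop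

theorem hasCompactSupport_slice (hs : HasCompactSupport h) (n : ℤ) :
    HasCompactSupport fun ξ => h (ξ, n) := by
  refine HasCompactSupport.of_support_subset_isCompact (K := Prod.fst '' tsupport h)
    (hs.isCompact.image continuous_fst) fun ξ hξ => ⟨(ξ, n), subset_tsupport h hξ, rfl⟩

theorem exists_finset_slice (hs : HasCompactSupport h) :
    ∃ S : Finset ℤ, ∀ n ∉ S, ∀ ξ, h (ξ, n) = 0 := by
  have hfin : (Prod.snd '' tsupport h).Finite :=
    isCompact_iff_finite.1 (hs.isCompact.image continuous_snd)
  refine ⟨hfin.toFinset, fun n hn ξ => ?_⟩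
  by_contra hne
  exact hn (hfin.mem_toFinset.2 ⟨(ξ, n), subset_tsupport h hne, rfl⟩)

theorem memLp_slice (hh : MemLp h 2 freqMeasure) (n : ℤ) :
    MemLp (fun ξ => h (ξ, n)) 2 (volume : Measure ℝ) := by
  have h1 : AEStronglyMeasurable (fun ξ => h (ξ, n)) (volume : Measure ℝ) := by
    have := hh.1.prod_swap.prodMk_left
    -- Only the empty set is null for counting measure, so almost every `n` means every `n`.
    rw [Filter.eventually_iff, mem_ae_iff, Measure.count_eq_zero_iff] at this
    exact Set.eq_univ_iff_forall.1 (Set.compl_empty_iff.1 this) n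
  refine ⟨h1, ?_⟩
  rw [eLpNorm_lt_top_iff_lintegral_rpow_enorm_lt_top (by norm_num) (by norm_num)]
  have h2 := (eLpNorm_lt_top_iff_lintegral_rpow_enorm_lt_top (by norm_num) (by norm_num)).1 hh.2
  rw [lintegral_freq (by exact hh.1.enorm.pow_const _)] at h2
  exact (ENNReal.le_tsum n).trans_lt h2

theorem eLpNorm_two_sq {α : Type*} [MeasurableSpace α] {μ : Measure α} (f : α → ℂ) :
    eLpNorm f 2 μ ^ 2 = ∫⁻ x, ‖f x‖ₑ ^ 2 ∂μ := by
  have := eLpNorm_nnreal_pow_eq_lintegral (f := f) (μ := μ) (p := 2) (by norm_num)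
  simpa using this

theorem eLpNorm_two_sq_freq (hh : MemLp h 2 freqMeasure) :
    eLpNorm h 2 freqMeasure ^ 2 = ∑' n, ‖(memLp_slice hh n).toLp _‖ₑ ^ 2 := by
  rw [eLpNorm_two_sq, lintegral_freq (by exact hh.1.enorm.pow_const _)]
  simp_rw [Lp.enorm_toLp, eLpNorm_two_sq]

/-- The modes of the function on the cylinder with Fourier transform `h`. -/
noncomputable def freqMode (h : Freq → ℂ) (hh : MemLp h 2 freqMeasure) (n : ℤ) : L2Cylinder :=
  tensorMode (𝓕⁻ ((memLp_slice hh n).toLp _)) n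

/-- The element of `L²(ℝ × 𝕋)` with Fourier transform `h ∈ L²(ℝ × ℤ)`. -/
noncomputable def freqSynthLp (h : Freq → ℂ) (hh : MemLp h 2 freqMeasure) : L2Cylinder :=
  ∑' n, freqMode h hh n

theorem norm_fourierInv_L2Line (g : L2Line) : ‖(𝓕⁻ g : L2Line)‖ = ‖g‖ := by
  rw [← Lp.norm_fourier_eq, fourier_fourierInv_eq]

theorem summable_sq_slice (hh : MemLp h 2 freqMeasure) :
    Summable fun n => ‖(memLp_slice hh n).toLp _‖ ^ 2 := by
  have h1 : ∑' n, ‖(memLp_slice hh n).toLp _‖ₑ ^ 2 ≠ ∞ := by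
    rw [← eLpNorm_two_sq_freq hh]
    exact ENNReal.pow_ne_top hh.2.ne
  have h2 := ENNReal.summable_toReal h1
  simpa using h2

theorem summable_freqMode (hh : MemLp h 2 freqMeasure) : Summable (freqMode h hh) := by
  refine (orthogonalFamily_tensorMode.summable_iff_norm_sq_summable
    (fun n => (𝓕⁻ ((memLp_slice hh n).toLp _) : L2Line))).2 ?_
  simp only [norm_fourierInv_L2Line]
  exact summable_sq_slice hh

theorem norm_sq_freqSynthLp (hh : MemLp h 2 freqMeasure) :
    ‖freqSynthLp h hh‖ ^ 2 = ∑' n, ‖(memLp_slice hh n).toLp _‖ ^ 2 := by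
  have h1 := ((summable_freqMode hh).hasSum.norm).pow 2
  refine tendsto_nhds_unique h1 ?_
  refine (summable_sq_slice hh).hasSum.congr fun s => ?_
  refine Eq.trans ?_ (orthogonalFamily_tensorMode.norm_sum
    (fun n => (𝓕⁻ ((memLp_slice hh n).toLp _) : L2Line)) s).symm
  simp only [norm_fourierInv_L2Line]

theorem enorm_freqSynthLp (hh : MemLp h 2 freqMeasure) :
    ‖freqSynthLp h hh‖ₑ = eLpNorm h 2 freqMeasure := by
  have h1 : ‖freqSynthLp h hh‖ₑ ^ 2 = eLpNorm h 2 freqMeasure ^ 2 := by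
    rw [eLpNorm_two_sq_freq hh, ← ofReal_norm, ← ENNReal.ofReal_pow (norm_nonneg _),
      norm_sq_freqSynthLp hh,
      ENNReal.ofReal_tsum_of_nonneg (fun n => sq_nonneg _) (summable_sq_slice hh)]
    simp_rw [ENNReal.ofReal_pow (norm_nonneg _), ofReal_norm]
  exact (ENNReal.pow_right_strictMono two_ne_zero).injective h1

theorem freqSynthLp_sub {h' : Freq → ℂ} (hh : MemLp h 2 freqMeasure)
    (hh' : MemLp h' 2 freqMeasure) :
    freqSynthLp (h - h') (hh.sub hh') = freqSynthLp h hh - freqSynthLp h' hh' := by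
  unfold freqSynthLp
  rw [← (summable_freqMode hh).tsum_sub (summable_freqMode hh')]
  congr 1
  funext n
  have h1 : (memLp_slice (hh.sub hh') n).toLp _ =
      (memLp_slice hh n).toLp _ - (memLp_slice hh' n).toLp _ := rfl
  have h2 := (Lp.fourierTransformₗᵢ ℝ ℂ).symm.map_sub
    ((memLp_slice hh n).toLp _) ((memLp_slice hh' n).toLp _)
  unfold freqMode
  rw [h1]
  exact (congrArg (tensorModeIsometry n) h2).trans ((tensorModeIsometry n).map_sub _ _)

theorem memLp_two_of_hasCompactSupport (hc : Continuous h) (hs : HasCompactSupport h) :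
    MemLp h 2 freqMeasure := hc.memLp_of_hasCompactSupport hs

theorem freqSynth_eq_sum (hc : Continuous h) (hs : HasCompactSupport h) {S : Finset ℤ}
    (hS : ∀ n ∉ S, ∀ ξ, h (ξ, n) = 0) (x : Cylinder) :
    freqSynth h x = ∑ n ∈ S, 𝓕⁻ (fun ξ => h (ξ, n)) x.1 * fourier n x.2 := by
  have hint : Integrable (fun p => freqChar p x * h p) freqMeasure :=
    ((continuous_freqChar_left x).mul hc).integrable_of_hasCompactSupport hs.mul_left
  unfold freqSynth
  rw [integral_prod_symm _ hint, integral_countable hint.integral_prod_right]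
  rw [tsum_eq_sum (s := S) fun n hn => by simp [hS n hn]]
  refine Finset.sum_congr rfl fun n _ => ?_
  rw [measureReal_def, Measure.count_singleton, ENNReal.toReal_one, one_smul,
    Real.fourierInv_eq', ← integral_mul_const]
  refine integral_congr_ae (Filter.Eventually.of_forall fun ξ => ?_)
  simp only [freqChar, smul_eq_mul, RCLike.inner_apply, conj_trivial]
  rw [mul_comm x.1 ξ]
  ring

theorem coeFn_freqSynthLp (hc : Continuous h) (hs : HasCompactSupport h)
    (hh : MemLp h 2 freqMeasure) : freqSynthLp h hh =ᵐ[volume] freqSynth h := by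
  have := isProbabilityMeasure_unitAddCircle
  obtain ⟨S, hS⟩ := exists_finset_slice hs
  have h1 : freqSynthLp h hh = ∑ n ∈ S, freqMode h hh n := by
    refine tsum_eq_sum fun n hn => ?_
    have h0 : (memLp_slice hh n).toLp _ = 0 := by
      rw [← norm_eq_zero, Lp.norm_toLp, ENNReal.toReal_eq_zero_iff]
      left
      simp [hS n hn]
    have h2 := (Lp.fourierTransformₗᵢ ℝ ℂ).symm.map_zero
    unfold freqMode
    rw [h0]
    exact (congrArg (tensorModeIsometry n) h2).trans (tensorModeIsometry n).map_zero
  have h2 : ∀ n, freqMode h hh n =ᵐ[volume]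
      fun x : Cylinder => 𝓕⁻ (fun ξ => h (ξ, n)) x.1 * fourier n x.2 := fun n => by
    have h3 : ∀ᵐ x : Cylinder, (𝓕⁻ ((memLp_slice hh n).toLp _) : L2Line) x.1 =
        𝓕⁻ (fun ξ => h (ξ, n)) x.1 :=
      Measure.quasiMeasurePreserving_fst.ae (coeFn_fourierInv_toLp
        ((continuous_slice hc n).integrable_of_hasCompactSupport (hasCompactSupport_slice hs n)) _)
    filter_upwards [coeFn_tensorMode (𝓕⁻ ((memLp_slice hh n).toLp _)) n, h3] with x h4 h5
    rw [freqMode, h4, h5]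
  have h3 : ∀ᵐ x : Cylinder, ∀ n : ℤ, freqMode h hh n x =
      𝓕⁻ (fun ξ => h (ξ, n)) x.1 * fourier n x.2 := ae_all_iff.2 h2
  rw [h1]
  filter_upwards [h3, Lp.coeFn_finsetSum S (freqMode h hh)] with x h4 h5
  rw [h5, freqSynth_eq_sum hc hs hS, Finset.sum_apply]
  exact Finset.sum_congr rfl fun n _ => h4 n

/-- Plancherel's identity on the cylinder. -/
theorem eLpNorm_freqSynth (hc : Continuous h) (hs : HasCompactSupport h) :
    eLpNorm (freqSynth h) 2 (volume : Measure Cylinder) = eLpNorm h 2 freqMeasure := by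
  have hh := memLp_two_of_hasCompactSupport hc hs
  rw [← eLpNorm_congr_ae (coeFn_freqSynthLp hc hs hh), ← enorm_freqSynthLp hh, Lp.enorm_def]

/-- Characters are multiplicative, and the integral of a convolution is the product of the
integrals. With Plancherel this turns the `L⁴` norm into the `L²` norm of a convolution. -/
theorem freqSynth_mul_self (hc : Continuous h) (hs : HasCompactSupport h) (x : Cylinder) :
    freqSynth h x * freqSynth h x =
      freqSynth (convolution h h (ContinuousLinearMap.mul ℂ ℂ) freqMeasure) x := by
  have hint : Integrable (fun p => freqChar p x * h p) freqMeasure :=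
    ((continuous_freqChar_left x).mul hc).integrable_of_hasCompactSupport hs.mul_left
  have h1 := integral_convolution (ContinuousLinearMap.mul ℂ ℂ) hint hint
  rw [ContinuousLinearMap.mul_apply'] at h1
  unfold freqSynth
  rw [← h1]
  refine integral_congr_ae (Filter.Eventually.of_forall fun q => ?_)
  simp only [convolution_def, ContinuousLinearMap.mul_apply']
  rw [← integral_const_mul]
  refine integral_congr_ae (Filter.Eventually.of_forall fun p => ?_)
  have h2 := freqChar_add p (q - p) x
  rw [add_sub_cancel] at h2
  simp only [h2]
  ring

theorem continuous_convolution_self (hc : Continuous h) (hs : HasCompactSupport h) :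
    Continuous (convolution h h (ContinuousLinearMap.mul ℂ ℂ) freqMeasure) :=
  hs.continuous_convolution_right _ hc.locallyIntegrable hc

theorem hasCompactSupport_convolution_self (hs : HasCompactSupport h) :
    HasCompactSupport (convolution h h (ContinuousLinearMap.mul ℂ ℂ) freqMeasure) :=
  hs.convolution _ hs

end Slices

/-! ### The estimate for continuous, compactly supported Fourier transforms. -/

/-- A Gaussian average in time of the square of an oscillatory integral is controlled by
the nearly resonant pairs. -/
theorem lintegral_gaussian_oscillatory_le {Y : Type*} [MeasurableSpace Y] {μ : Measure Y}
    [SigmaFinite μ] {a : Y → ℂ} (ha : Integrable a μ) {ω : Y → ℝ} (hω : Measurable ω) :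
    ∫⁻ t : ℝ, ENNReal.ofReal (Real.exp (-1 * t ^ 2)) *
        ‖∫ y, a y * Complex.exp ((t * ω y : ℝ) * Complex.I) ∂μ‖ₑ ^ 2 ≤
      ENNReal.ofReal (√Real.pi) * ∫⁻ y, ∫⁻ y', ‖a y‖ₑ * ‖a y'‖ₑ *
        ENNReal.ofReal (Real.exp (-(ω y - ω y') ^ 2 / 4)) ∂μ ∂μ := by
  set A : ℝ → ℂ := fun t => ∫ y, a y * Complex.exp ((t * ω y : ℝ) * Complex.I) ∂μ with hA
  set Φ : ℝ × (Y × Y) → ℂ := fun q => ((Real.exp (-1 * q.1 ^ 2) : ℝ) : ℂ) *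
    (a q.2.1 * (starRingEnd ℂ) (a q.2.2)) *
      Complex.exp ((q.1 * (ω q.2.1 - ω q.2.2) : ℝ) * Complex.I) with hΦ
  have hconj : Integrable (fun y => (starRingEnd ℂ) (a y)) μ :=
    ha.mono (RCLike.continuous_conj.comp_aestronglyMeasurable ha.1)
      (Filter.Eventually.of_forall fun y => by simp)
  have hgauss : Integrable (fun t : ℝ => ((Real.exp (-1 * t ^ 2) : ℝ) : ℂ)) :=
    (integrable_exp_neg_mul_sq one_pos).ofReal
  have hprod := hgauss.mul_prod (ha.mul_prod hconj)
  have hΦint : Integrable Φ ((volume : Measure ℝ).prod (μ.prod μ)) := by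
    refine hprod.mono (hprod.1.mul ?_) (Filter.Eventually.of_forall fun q => ?_)
    · refine Measurable.aestronglyMeasurable ?_
      fun_prop
    · simp only [hΦ]
      rw [norm_mul (_ * _), Complex.norm_exp_ofReal_mul_I, mul_one]
  -- The square of the modulus is written as a double integral over `(y, y')`.
  have hAA : ∀ t, ∫ q, Φ (t, q) ∂(μ.prod μ) =
      ((Real.exp (-1 * t ^ 2) * ‖A t‖ ^ 2 : ℝ) : ℂ) := fun t => by
    have h1 := integral_prod_mul (μ := μ) (ν := μ)
      (fun y => a y * Complex.exp ((t * ω y : ℝ) * Complex.I))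
      (fun y => (starRingEnd ℂ) (a y * Complex.exp ((t * ω y : ℝ) * Complex.I)))
    rw [integral_conj, Complex.mul_conj, Complex.normSq_eq_norm_sq] at h1
    rw [Complex.ofReal_mul, ← h1, ← integral_const_mul]
    refine integral_congr_ae (Filter.Eventually.of_forall fun q => ?_)
    simp only [hΦ, map_mul, ← Complex.exp_conj, Complex.conj_ofReal, Complex.conj_I]
    have h2 : Complex.exp ((t * (ω q.1 - ω q.2) : ℝ) * Complex.I) =
        Complex.exp ((t * ω q.1 : ℝ) * Complex.I) *
          Complex.exp ((t * ω q.2 : ℝ) * -Complex.I) := by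
      rw [← Complex.exp_add]
      congr 1
      push_cast
      ring
    rw [h2]
    ring
  have hreal : Integrable (fun t => Real.exp (-1 * t ^ 2) * ‖A t‖ ^ 2) := by
    have := hΦint.integral_prod_left
    simp_rw [hAA] at this
    exact this.re
  -- By Fubini the time integral comes first; it is the Fourier transform of a Gaussian at `ω y - ω
  -- y'`.
  have hswap : ((∫ t, Real.exp (-1 * t ^ 2) * ‖A t‖ ^ 2 : ℝ) : ℂ) =
      ∫ q, (a q.1 * (starRingEnd ℂ) (a q.2)) *
        ((√Real.pi * Real.exp (-(ω q.1 - ω q.2) ^ 2 / 4) : ℝ) : ℂ) ∂(μ.prod μ) := by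
    rw [← integral_complex_ofReal]
    simp_rw [← hAA]
    rw [integral_integral_swap hΦint]
    refine integral_congr_ae (Filter.Eventually.of_forall fun q => ?_)
    have h1 := fourierIntegral_gaussian (b := 1) (by simp) ((ω q.1 - ω q.2 : ℝ) : ℂ)
    have h2 : ((Real.pi : ℂ) / 1) ^ (1 / 2 : ℂ) = ((√Real.pi : ℝ) : ℂ) := by
      rw [div_one, Real.sqrt_eq_rpow, Complex.ofReal_cpow Real.pi_nonneg]
      norm_num
    rw [h2] at h1
    simp only
    rw [Complex.ofReal_mul, Complex.ofReal_exp,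
      show ((-(ω q.1 - ω q.2) ^ 2 / 4 : ℝ) : ℂ) = -((ω q.1 - ω q.2 : ℝ) : ℂ) ^ 2 / (4 * 1) by
        push_cast; ring, ← h1, ← integral_const_mul]
    refine integral_congr_ae (Filter.Eventually.of_forall fun t => ?_)
    simp only [hΦ]
    push_cast
    ring_nf
  calc ∫⁻ t : ℝ, ENNReal.ofReal (Real.exp (-1 * t ^ 2)) * ‖A t‖ₑ ^ 2
      = ∫⁻ t : ℝ, ENNReal.ofReal (Real.exp (-1 * t ^ 2) * ‖A t‖ ^ 2) := by
        refine lintegral_congr fun t => ?_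
        rw [ENNReal.ofReal_mul (by positivity), ENNReal.ofReal_pow (norm_nonneg _), ofReal_norm]
    _ = ENNReal.ofReal (∫ t, Real.exp (-1 * t ^ 2) * ‖A t‖ ^ 2) :=
        (ofReal_integral_eq_lintegral_ofReal hreal
          (Filter.Eventually.of_forall fun t => by positivity)).symm
    _ = ‖((∫ t, Real.exp (-1 * t ^ 2) * ‖A t‖ ^ 2 : ℝ) : ℂ)‖ₑ := by
        rw [← ofReal_norm, Complex.norm_real, Real.norm_of_nonneg]
        exact integral_nonneg fun t => by positivity
    _ ≤ ∫⁻ q, ‖(a q.1 * (starRingEnd ℂ) (a q.2)) *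
        ((√Real.pi * Real.exp (-(ω q.1 - ω q.2) ^ 2 / 4) : ℝ) : ℂ)‖ₑ ∂(μ.prod μ) := by
        rw [hswap]
        exact enorm_integral_le_lintegral_enorm _
    _ = ∫⁻ q, ENNReal.ofReal (√Real.pi) * (‖a q.1‖ₑ * ‖a q.2‖ₑ *
        ENNReal.ofReal (Real.exp (-(ω q.1 - ω q.2) ^ 2 / 4))) ∂(μ.prod μ) := by
        refine lintegral_congr fun q => ?_
        rw [enorm_mul, enorm_mul, RCLike.enorm_conj, Complex.ofReal_mul, enorm_mul,
          ← ofReal_norm (((√Real.pi : ℝ) : ℂ)), ← ofReal_norm ((Real.exp _ : ℝ) : ℂ),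
          Complex.norm_real, Complex.norm_real, Real.norm_of_nonneg (Real.sqrt_nonneg _),
          Real.norm_of_nonneg (Real.exp_pos _).le]
        ring
    _ = _ := by
        have hm : AEMeasurable (fun q : Y × Y => ‖a q.1‖ₑ * ‖a q.2‖ₑ *
            ENNReal.ofReal (Real.exp (-(ω q.1 - ω q.2) ^ 2 / 4))) (μ.prod μ) :=
          ((ha.1.comp_fst (ν := μ)).enorm.mul (ha.1.comp_snd (μ := μ)).enorm).mul
            (Measurable.aemeasurable (by fun_prop))
        rw [lintegral_const_mul'' _ hm, lintegral_prod _ hm]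

/-- The action of the flow on the frequency side. -/
noncomputable def freqFlow (t : ℝ) (h : Freq → ℂ) (p : Freq) : ℂ := flowSymbol t p.2 p.1 * h p

/-- The time frequency of the mode `p`. -/
noncomputable def freqPhase (p : Freq) : ℝ := -4 * Real.pi ^ 2 * (p.1 ^ 2 - (p.2 : ℝ) ^ 2)

theorem flowSymbol_eq (t : ℝ) (p : Freq) :
    flowSymbol t p.2 p.1 = Complex.exp ((t * freqPhase p : ℝ) * Complex.I) := by
  unfold flowSymbol freqPhase
  congr 3
  ring

theorem continuous_freqPhase : Continuous freqPhase := by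
  have h : Continuous fun n : ℤ => (n : ℝ) := continuous_of_discreteTopology
  unfold freqPhase
  fun_prop

theorem norm_freqFlow (t : ℝ) (h : Freq → ℂ) (p : Freq) : ‖freqFlow t h p‖ = ‖h p‖ := by
  rw [freqFlow, norm_mul, norm_flowSymbol, one_mul]

theorem continuous_freqFlow_uncurry {h : Freq → ℂ} (hc : Continuous h) :
    Continuous fun q : ℝ × Freq => freqFlow q.1 h q.2 := by
  have := continuous_freqPhase
  unfold freqFlow
  simp_rw [flowSymbol_eq]
  fun_prop

theorem continuous_freqFlow {h : Freq → ℂ} (hc : Continuous h) (t : ℝ) :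
    Continuous (freqFlow t h) :=
  (continuous_freqFlow_uncurry hc).comp (Continuous.prodMk_right t)

theorem hasCompactSupport_freqFlow {h : Freq → ℂ} (hs : HasCompactSupport h) (t : ℝ) :
    HasCompactSupport (freqFlow t h) := hs.mul_left

theorem freqPhase_parallelogram (p w z : Freq) :
    (freqPhase p + freqPhase (p - w - z)) - (freqPhase (p - w) + freqPhase (p - z)) =
      -8 * Real.pi ^ 2 * resonance w z := by
  simp only [freqPhase, resonance, Prod.fst_sub, Prod.snd_sub, Int.cast_sub]
  ring

/-- The exponent equals `-16π⁴` times the square of the resonance, and `16π⁴ ≥ 1`. -/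
theorem ofReal_exp_freqPhase_le (p w z : Freq) :
    ENNReal.ofReal (Real.exp (-((freqPhase p + freqPhase (p - w - z)) -
      (freqPhase (p - w) + freqPhase (p - z))) ^ 2 / 4)) ≤ gaussKernel w z := by
  rw [freqPhase_parallelogram]
  refine ENNReal.ofReal_le_ofReal (Real.exp_le_exp.2 ?_)
  have h1 : (1 : ℝ) ≤ Real.pi ^ 2 := by nlinarith [Real.pi_gt_three]
  have h2 : (1 : ℝ) ≤ (Real.pi ^ 2) ^ 2 := one_le_pow₀ h1
  nlinarith [mul_le_mul_of_nonneg_right h2 (sq_nonneg (resonance w z)), sq_nonneg (resonance w z)]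

theorem convolution_freqFlow (h : Freq → ℂ) (t : ℝ) (c : Freq) :
    convolution (freqFlow t h) (freqFlow t h) (ContinuousLinearMap.mul ℂ ℂ) freqMeasure c =
      ∫ p, h p * h (c - p) * Complex.exp ((t * (freqPhase p + freqPhase (c - p)) : ℝ) * Complex.I)
        ∂freqMeasure := by
  rw [convolution_def]
  refine integral_congr_ae (Filter.Eventually.of_forall fun p => ?_)
  simp only [ContinuousLinearMap.mul_apply', freqFlow, flowSymbol_eq]
  rw [mul_add, Complex.ofReal_add, add_mul, Complex.exp_add]
  ring

/-- The pairs `p, c - p` and `p', c - p'` with equal sum `c` are the diagonals of a parallelogram.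
The substitution `p' = p - w`, `c = p + p' - z` passes to a vertex and two sides and preserves the
measure. -/
theorem lintegral_vertices_eq_sides {G : Freq → Freq → Freq → ℝ≥0∞}
    (hG : Measurable fun q : Freq × Freq × Freq => G q.1 q.2.1 q.2.2) :
    ∫⁻ c, ∫⁻ p, ∫⁻ p', G c p p' ∂freqMeasure ∂freqMeasure ∂freqMeasure =
      ∫⁻ p, ∫⁻ w, ∫⁻ z, G (p + (p - w) - z) p (p - w)
        ∂freqMeasure ∂freqMeasure ∂freqMeasure := by
  have h1 : Measurable fun q : (Freq × Freq) × Freq => G q.1.1 q.1.2 q.2 :=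
    hG.comp (by fun_prop : Measurable fun q : (Freq × Freq) × Freq => (q.1.1, q.1.2, q.2))
  rw [lintegral_lintegral_swap (Measurable.aemeasurable h1.lintegral_prod_right')]
  refine lintegral_congr fun p => ?_
  have h2 : Measurable fun q : Freq × Freq => G q.1 p q.2 :=
    hG.comp (by fun_prop : Measurable fun q : Freq × Freq => (q.1, p, q.2))
  rw [lintegral_lintegral_swap h2.aemeasurable, ← lintegral_sub_left_eq_self _ p]
  exact lintegral_congr fun w =>
    (lintegral_sub_left_eq_self (fun c => G c p (p - w)) (p + (p - w))).symm

theorem lintegral_convolution_freqFlow_le {h : Freq → ℂ} (hc : Continuous h)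
    (hs : HasCompactSupport h) :
    ∫⁻ c, ∫⁻ t : ℝ, ENNReal.ofReal (Real.exp (-1 * t ^ 2)) *
        ‖convolution (freqFlow t h) (freqFlow t h) (ContinuousLinearMap.mul ℂ ℂ)
          freqMeasure c‖ₑ ^ 2 ∂volume ∂freqMeasure ≤
      ENNReal.ofReal (√Real.pi) * parallelogramForm (fun p => ‖h p‖ₑ) gaussKernel := by
  have hphase := continuous_freqPhase
  have hhm := hc.measurable
  have hpm := hphase.measurable
  set G : Freq → Freq → Freq → ℝ≥0∞ := fun c p p' =>
    ‖h p * h (c - p)‖ₑ * ‖h p' * h (c - p')‖ₑ *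
      ENNReal.ofReal (Real.exp (-((freqPhase p + freqPhase (c - p)) -
        (freqPhase p' + freqPhase (c - p'))) ^ 2 / 4)) with hG
  have hGm : Measurable fun q : Freq × Freq × Freq => G q.1 q.2.1 q.2.2 := by
    simp only [hG]
    fun_prop
  calc _ ≤ ∫⁻ c, ENNReal.ofReal (√Real.pi) *
        ∫⁻ p, ∫⁻ p', G c p p' ∂freqMeasure ∂freqMeasure ∂freqMeasure := by
        refine lintegral_mono fun c => ?_
        simp_rw [convolution_freqFlow]
        refine lintegral_gaussian_oscillatory_le (a := fun p => h p * h (c - p))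
          (ω := fun p => freqPhase p + freqPhase (c - p)) ?_ (by fun_prop)
        exact (by fun_prop : Continuous fun p => h p * h (c - p)).integrable_of_hasCompactSupport
          hs.mul_right
    _ = ENNReal.ofReal (√Real.pi) * ∫⁻ p, ∫⁻ w, ∫⁻ z, G (p + (p - w) - z) p (p - w)
        ∂freqMeasure ∂freqMeasure ∂freqMeasure := by
        rw [lintegral_const_mul' _ _ ENNReal.ofReal_ne_top, lintegral_vertices_eq_sides hGm]
    _ ≤ _ := by
        unfold parallelogramForm
        gcongr with p w z
        have e1 : p + (p - w) - z - p = p - w - z := by abel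
        have e2 : p + (p - w) - z - (p - w) = p - z := by abel
        simp only [hG]
        rw [e1, e2, enorm_mul, enorm_mul]
        refine (mul_le_mul_right (ofReal_exp_freqPhase_le p w z) _).trans_eq ?_
        ring

/-- The `L⁴` Strichartz estimate for continuous and compactly supported Fourier transforms. -/
theorem exists_lintegral_freqSynth_freqFlow_le :
    ∃ C : ℝ≥0∞, C ≠ ∞ ∧ ∀ h : Freq → ℂ, Continuous h → HasCompactSupport h →
      ∫⁻ t in Set.Icc (0 : ℝ) 1, ∫⁻ x : Cylinder, ‖freqSynth (freqFlow t h) x‖ₑ ^ 4 ≤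
        C * (∫⁻ p, ‖h p‖ₑ ^ 2 ∂freqMeasure) ^ 2 := by
  obtain ⟨C, hC, hform⟩ := exists_parallelogramForm_gaussKernel_le
  refine ⟨ENNReal.ofReal (Real.exp 1) * (ENNReal.ofReal (√Real.pi) * C), by finiteness,
    fun h hc hs => ?_⟩
  set H : ℝ → Freq → ℂ := fun t =>
    convolution (freqFlow t h) (freqFlow t h) (ContinuousLinearMap.mul ℂ ℂ) freqMeasure with hH
  have hslice : ∀ t, ∫⁻ x : Cylinder, ‖freqSynth (freqFlow t h) x‖ₑ ^ 4 =
      ∫⁻ c, ‖H t c‖ₑ ^ 2 ∂freqMeasure := fun t => by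
    have hct := continuous_freqFlow hc t
    have hst := hasCompactSupport_freqFlow hs t
    rw [← eLpNorm_two_sq, ← eLpNorm_freqSynth (continuous_convolution_self hct hst)
      (hasCompactSupport_convolution_self hst), eLpNorm_two_sq]
    refine lintegral_congr fun x => ?_
    rw [← freqSynth_mul_self hct hst, enorm_mul]
    ring
  have hHm : Measurable fun q : ℝ × Freq => H q.1 q.2 := by
    have hphase := continuous_freqPhase
    simp only [hH, convolution_freqFlow]
    refine StronglyMeasurable.measurable (StronglyMeasurable.integral_prod_right' (f :=
      fun q : (ℝ × Freq) × Freq => h q.2 * h (q.1.2 - q.2) * Complex.exp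
        ((q.1.1 * (freqPhase q.2 + freqPhase (q.1.2 - q.2)) : ℝ) * Complex.I)) ?_)
    exact Continuous.stronglyMeasurable (by fun_prop)
  calc ∫⁻ t in Set.Icc (0 : ℝ) 1, ∫⁻ x : Cylinder, ‖freqSynth (freqFlow t h) x‖ₑ ^ 4
      ≤ ∫⁻ t in Set.Icc (0 : ℝ) 1, ENNReal.ofReal (Real.exp 1) *
          ∫⁻ c, ENNReal.ofReal (Real.exp (-1 * t ^ 2)) * ‖H t c‖ₑ ^ 2 ∂freqMeasure := by
        refine setLIntegral_mono' measurableSet_Icc fun t ht => ?_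
        rw [hslice, lintegral_const_mul' _ _ ENNReal.ofReal_ne_top, ← mul_assoc,
          ← ENNReal.ofReal_mul (Real.exp_pos _).le, ← Real.exp_add]
        -- On `[0,1]` one has `1 ≤ e · exp(-t²)`.
        refine le_mul_of_one_le_left' (ENNReal.one_le_ofReal.2 (Real.one_le_exp ?_))
        nlinarith [ht.1, ht.2]
    _ ≤ ∫⁻ t : ℝ, ENNReal.ofReal (Real.exp 1) *
          ∫⁻ c, ENNReal.ofReal (Real.exp (-1 * t ^ 2)) * ‖H t c‖ₑ ^ 2 ∂freqMeasure :=
        setLIntegral_le_lintegral _ _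
    _ = ENNReal.ofReal (Real.exp 1) * ∫⁻ c, ∫⁻ t : ℝ,
          ENNReal.ofReal (Real.exp (-1 * t ^ 2)) * ‖H t c‖ₑ ^ 2 ∂volume ∂freqMeasure := by
        have hm : Measurable fun q : ℝ × Freq =>
            ENNReal.ofReal (Real.exp (-1 * q.1 ^ 2)) * ‖H q.1 q.2‖ₑ ^ 2 := by fun_prop
        rw [lintegral_const_mul' _ _ ENNReal.ofReal_ne_top,
          lintegral_lintegral_swap hm.aemeasurable]
    _ ≤ ENNReal.ofReal (Real.exp 1) * (ENNReal.ofReal (√Real.pi) *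
          (C * (∫⁻ p, ‖h p‖ₑ ^ 2 ∂freqMeasure) ^ 2)) := by
        gcongr
        exact (lintegral_convolution_freqFlow_le hc hs).trans
          (by gcongr; exact hform _ hc.measurable.enorm)
    _ = _ := by ring

/-! ### Extension to all of `L²` by density. -/

theorem memLp_freqFlow {h : Freq → ℂ} (hh : MemLp h 2 freqMeasure) (t : ℝ) :
    MemLp (freqFlow t h) 2 freqMeasure := by
  have hm : Continuous fun p : Freq => flowSymbol t p.2 p.1 := by
    have := continuous_freqPhase
    simp_rw [flowSymbol_eq]
    fun_prop
  exact hh.of_le (hm.aestronglyMeasurable.mul hh.1)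
    (Filter.Eventually.of_forall fun p => (norm_freqFlow t h p).le)

theorem freqFlow_sub (t : ℝ) (h h' : Freq → ℂ) :
    freqFlow t (h - h') = freqFlow t h - freqFlow t h' :=
  funext fun _ => mul_sub _ _ _

theorem eLpNorm_freqFlow (t : ℝ) (h : Freq → ℂ) :
    eLpNorm (freqFlow t h) 2 freqMeasure = eLpNorm h 2 freqMeasure :=
  eLpNorm_congr_norm_ae (Filter.Eventually.of_forall (norm_freqFlow t h))

/-- The Fourier transform of `φ` as a function on `ℝ × ℤ`. -/
noncomputable def freqData (φ : L2Cylinder) (p : Freq) : ℂ := cylinderFourier φ p.2 p.1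

theorem measurable_freqData (φ : L2Cylinder) : Measurable (freqData φ) :=
  measurable_from_prod_countable_left fun n =>
    (Lp.stronglyMeasurable (cylinderFourier φ n)).measurable

/-- Bessel's inequality for the modes; completeness of the characters is not needed. -/
theorem eLpNorm_freqData_le (φ : L2Cylinder) :
    eLpNorm (freqData φ) 2 freqMeasure ≤ eLpNorm φ 2 (volume : Measure Cylinder) := by
  have h1 : eLpNorm (freqData φ) 2 freqMeasure ^ 2 = ∑' n, ‖partialCoeff φ n‖ₑ ^ 2 := by
    rw [eLpNorm_two_sq,
      lintegral_freq (by exact (measurable_freqData φ).aemeasurable.enorm.pow_const _)]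
    refine tsum_congr fun n => ?_
    rw [← ofReal_norm, ← Lp.norm_fourier_eq, ofReal_norm, Lp.enorm_def, eLpNorm_two_sq]
    rfl
  have h2 : eLpNorm (freqData φ) 2 freqMeasure ^ 2 ≤
      eLpNorm φ 2 (volume : Measure Cylinder) ^ 2 := by
    rw [h1, ← Lp.enorm_def]
    refine ENNReal.summable.tsum_le_of_sum_le fun s => ?_
    have h3 := ENNReal.ofReal_le_ofReal (sum_sq_norm_partialCoeff_le φ s)
    rw [ENNReal.ofReal_sum_of_nonneg fun _ _ => sq_nonneg _] at h3
    simpa only [ENNReal.ofReal_pow (norm_nonneg _), ofReal_norm] using h3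
  exact (ENNReal.pow_right_strictMono two_ne_zero).le_iff_le.1 h2

theorem memLp_freqData (φ : L2Cylinder) : MemLp (freqData φ) 2 freqMeasure :=
  ⟨(measurable_freqData φ).aestronglyMeasurable,
    (eLpNorm_freqData_le φ).trans_lt (Lp.memLp φ).2⟩

/-- Both sides unfold to the same series of modes. -/
theorem hyperbolicFlow_eq_freqSynthLp (t : ℝ) (φ : L2Cylinder) :
    hyperbolicFlow t φ =
      freqSynthLp (freqFlow t (freqData φ)) (memLp_freqFlow (memLp_freqData φ) t) := rfl

/-- The solution on the cylinder with initial Fourier transform `h`. -/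
noncomputable def freqSolution (h : Freq → ℂ) (q : ℝ × Cylinder) : ℂ :=
  freqSynth (freqFlow q.1 h) q.2

section Solution

variable {h h' : Freq → ℂ}

theorem integrable_freqChar_mul (hc : Continuous h) (hs : HasCompactSupport h) (x : Cylinder) :
    Integrable (fun p => freqChar p x * h p) freqMeasure :=
  ((continuous_freqChar_left x).mul hc).integrable_of_hasCompactSupport hs.mul_left

theorem continuous_freqSolution (hc : Continuous h) (hs : HasCompactSupport h) :
    Continuous (freqSolution h) := by
  refine continuous_of_dominated (bound := fun p => ‖h p‖) (fun q => ?_) (fun q => ?_)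
    (hc.integrable_of_hasCompactSupport hs).norm (Filter.Eventually.of_forall fun p => ?_)
  · exact (integrable_freqChar_mul (continuous_freqFlow hc q.1)
      (hasCompactSupport_freqFlow hs q.1) q.2).1
  · exact Filter.Eventually.of_forall fun p => by
      rw [norm_mul, norm_freqChar, one_mul, norm_freqFlow]
  · exact ((continuous_freqChar_right p).comp continuous_snd).mul
      ((continuous_freqFlow_uncurry hc).comp (continuous_fst.prodMk continuous_const))

theorem freqSolution_sub (hc : Continuous h) (hs : HasCompactSupport h) (hc' : Continuous h')
    (hs' : HasCompactSupport h') :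
    freqSolution (h - h') = freqSolution h - freqSolution h' := by
  funext q
  simp only [freqSolution, freqSynth, Pi.sub_apply, freqFlow_sub, mul_sub]
  exact integral_sub (integrable_freqChar_mul (continuous_freqFlow hc q.1)
      (hasCompactSupport_freqFlow hs q.1) q.2) (integrable_freqChar_mul
      (continuous_freqFlow hc' q.1) (hasCompactSupport_freqFlow hs' q.1) q.2)

theorem lintegral_spaceTimeMeasure {f : ℝ × Cylinder → ℝ≥0∞}
    (hf : AEMeasurable f spaceTimeMeasure) :
    ∫⁻ q, f q ∂spaceTimeMeasure = ∫⁻ t in Set.Icc (0 : ℝ) 1, ∫⁻ x : Cylinder, f (t, x) :=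
  lintegral_prod f hf

/-- The time interval has length one, so a constant slice norm is the space-time norm. -/
theorem eLpNorm_two_spaceTimeMeasure {f : ℝ × Cylinder → ℂ}
    (hf : AEStronglyMeasurable f spaceTimeMeasure) {N : ℝ≥0∞}
    (hN : ∀ᵐ t ∂((volume : Measure ℝ).restrict (Set.Icc 0 1)),
      eLpNorm (fun x => f (t, x)) 2 volume = N) :
    eLpNorm f 2 spaceTimeMeasure = N := by
  refine (ENNReal.pow_right_strictMono two_ne_zero).injective ?_
  rw [eLpNorm_two_sq, lintegral_spaceTimeMeasure (by exact hf.enorm.pow_const 2)]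
  calc _ = ∫⁻ t in Set.Icc (0 : ℝ) 1, N ^ 2 := by
        refine lintegral_congr_ae ?_
        filter_upwards [hN] with t ht
        rw [← ht, eLpNorm_two_sq]
    _ = N ^ 2 := by simp

theorem eLpNorm_freqSolution (hc : Continuous h) (hs : HasCompactSupport h) :
    eLpNorm (freqSolution h) 2 spaceTimeMeasure = eLpNorm h 2 freqMeasure := by
  refine eLpNorm_two_spaceTimeMeasure (continuous_freqSolution hc hs).aestronglyMeasurable
    (Filter.Eventually.of_forall fun t => ?_)
  have h1 : (fun x => freqSolution h (t, x)) = freqSynth (freqFlow t h) := rfl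
  rw [h1, eLpNorm_freqSynth (continuous_freqFlow hc t) (hasCompactSupport_freqFlow hs t),
    eLpNorm_freqFlow]

theorem eLpNorm_freqSolution_sub_hyperbolicFlow (hc : Continuous h) (hs : HasCompactSupport h)
    (φ : L2Cylinder) (t : ℝ) :
    eLpNorm ((fun x => freqSolution h (t, x)) - ⇑(hyperbolicFlow t φ)) 2 volume =
      eLpNorm (h - freqData φ) 2 freqMeasure := by
  have hh := memLp_freqFlow (memLp_two_of_hasCompactSupport hc hs) t
  have h1 := coeFn_freqSynthLp (continuous_freqFlow hc t) (hasCompactSupport_freqFlow hs t) hh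
  have hf := memLp_freqFlow (memLp_freqData φ) t
  rw [← eLpNorm_freqFlow t, freqFlow_sub, ← enorm_freqSynthLp (hh.sub hf), freqSynthLp_sub hh hf,
    ← hyperbolicFlow_eq_freqSynthLp, Lp.enorm_def]
  refine eLpNorm_congr_ae ?_
  filter_upwards [h1, Lp.coeFn_sub (freqSynthLp _ hh) (hyperbolicFlow t φ)] with x h2 h3
  rw [h3, Pi.sub_apply, Pi.sub_apply, h2]
  rfl

theorem eLpNorm_freqSolution_sub (hc : Continuous h) (hs : HasCompactSupport h) {φ : L2Cylinder}
    {u : ℝ × Cylinder → ℂ} (hu : RepresentsFlow φ u) :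
    eLpNorm (freqSolution h - u) 2 spaceTimeMeasure = eLpNorm (h - freqData φ) 2 freqMeasure := by
  refine eLpNorm_two_spaceTimeMeasure
    ((continuous_freqSolution hc hs).aestronglyMeasurable.sub hu.1) ?_
  filter_upwards [hu.2] with t ht
  rw [← eLpNorm_freqSolution_sub_hyperbolicFlow hc hs φ t]
  refine eLpNorm_congr_ae ?_
  filter_upwards [ht] with x hx
  simp only [Pi.sub_apply, hx]

end Solution

/-- Continuous and compactly supported approximations of the Fourier transform of `φ`. -/
theorem exists_freqData_approx (φ : L2Cylinder) :
    ∃ h : ℕ → Freq → ℂ, (∀ k, Continuous (h k)) ∧ (∀ k, HasCompactSupport (h k)) ∧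
      ∀ k, eLpNorm (h k - freqData φ) 2 freqMeasure ≤ (2⁻¹ : ℝ≥0∞) ^ k := by
  have H : ∀ k : ℕ, ∃ g : Freq → ℂ, HasCompactSupport g ∧
      eLpNorm (freqData φ - g) 2 freqMeasure ≤ (2⁻¹ : ℝ≥0∞) ^ k ∧ Continuous g ∧
        MemLp g 2 freqMeasure := fun k =>
    (memLp_freqData φ).exists_hasCompactSupport_eLpNorm_sub_le (by norm_num)
      (pow_ne_zero _ (by norm_num))
  choose h h1 h2 h3 _ using H
  exact ⟨h, h3, h1, fun k => by rw [eLpNorm_sub_comm]; exact h2 k⟩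

theorem tendsto_inv_two_pow :
    Filter.Tendsto (fun k : ℕ => (2⁻¹ : ℝ≥0∞) ^ k) Filter.atTop (nhds 0) :=
  ENNReal.tendsto_pow_atTop_nhds_zero_of_lt_one (by norm_num)

/-- The flow has a jointly measurable representative. -/
theorem exists_representsFlow (φ : L2Cylinder) : ∃ u, RepresentsFlow φ u := by
  obtain ⟨h, hc, hs, happrox⟩ := exists_freqData_approx φ
  have hmem : ∀ k, MemLp (freqSolution (h k)) 2 spaceTimeMeasure := fun k =>
    ⟨(continuous_freqSolution (hc k) (hs k)).aestronglyMeasurable, by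
      rw [eLpNorm_freqSolution (hc k) (hs k)]
      exact (memLp_two_of_hasCompactSupport (hc k) (hs k)).2⟩
  have hB : ∑' N : ℕ, 3 * (2⁻¹ : ℝ≥0∞) ^ N ≠ ∞ := by
    rw [ENNReal.tsum_mul_left, ENNReal.tsum_geometric, ENNReal.one_sub_inv_two, inv_inv]
    finiteness
  have hcau : ∀ N n m : ℕ, N ≤ n → N ≤ m →
      eLpNorm (freqSolution (h n) - freqSolution (h m)) 2 spaceTimeMeasure <
        3 * (2⁻¹ : ℝ≥0∞) ^ N := fun N n m hn hm => by
    rw [← freqSolution_sub (hc n) (hs n) (hc m) (hs m),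
      eLpNorm_freqSolution ((hc n).sub (hc m)) ((hs n).sub (hs m)),
      ← sub_sub_sub_cancel_right (h n) (h m) (freqData φ)]
    have hle : ∀ k, N ≤ k → eLpNorm (h k - freqData φ) 2 freqMeasure ≤ (2⁻¹ : ℝ≥0∞) ^ N :=
      fun k hk => (happrox k).trans (pow_le_pow_right_of_le_one' (by norm_num) hk)
    calc _ ≤ eLpNorm (h n - freqData φ) 2 freqMeasure + eLpNorm (h m - freqData φ) 2 freqMeasure :=
          eLpNorm_sub_le
            ((hc n).aestronglyMeasurable.sub (measurable_freqData φ).aestronglyMeasurable)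
            ((hc m).aestronglyMeasurable.sub (measurable_freqData φ).aestronglyMeasurable)
            (by norm_num)
      _ ≤ 2 * (2⁻¹ : ℝ≥0∞) ^ N := by
          rw [two_mul]
          exact add_le_add (hle n hn) (hle m hm)
      -- The factor `3` in place of `2` provides the strict inequality required of a Cauchy sequence
      -- by `Lp.cauchy_complete_eLpNorm`.
      _ < 3 * (2⁻¹ : ℝ≥0∞) ^ N :=
          ENNReal.mul_lt_mul_left (pow_ne_zero _ (by norm_num))
            (ENNReal.pow_ne_top (by norm_num)) (by norm_num)
  obtain ⟨U, hU, hlim⟩ := Lp.cauchy_complete_eLpNorm (by norm_num) hmem hB hcau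
  refine ⟨U, hU.1, ?_⟩
  obtain ⟨ns, hns, hae⟩ := (tendstoInMeasure_of_tendsto_eLpNorm (by norm_num)
    (fun k => (hmem k).1) hU.1 hlim).exists_seq_tendsto_ae
  -- For almost every `t` the slices converge to that of `U` almost everywhere; they also converge
  -- in `L²` to the flow, so a further subsequence identifies the two limits.
  filter_upwards [Measure.ae_ae_of_ae_prod hae] with t ht
  have hlimt : Filter.Tendsto (fun k => eLpNorm ((fun x => freqSolution (h (ns k)) (t, x)) -
      ⇑(hyperbolicFlow t φ)) 2 volume) Filter.atTop (nhds 0) := by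
    simp_rw [eLpNorm_freqSolution_sub_hyperbolicFlow (hc _) (hs _)]
    exact tendsto_of_tendsto_of_tendsto_of_le_of_le tendsto_const_nhds
      (tendsto_inv_two_pow.comp hns.tendsto_atTop) (fun _ => zero_le) fun k => happrox (ns k)
  obtain ⟨ms, hms, haet⟩ := (tendstoInMeasure_of_tendsto_eLpNorm (by norm_num)
    (fun k => ((continuous_freqSolution (hc (ns k)) (hs (ns k))).comp
      (Continuous.prodMk_right t)).aestronglyMeasurable)
    (Lp.memLp (hyperbolicFlow t φ)).1 hlimt).exists_seq_tendsto_ae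
  filter_upwards [ht, haet] with x hx1 hx2
  exact tendsto_nhds_unique (hx1.comp hms.tendsto_atTop) hx2

/-- The `L⁴` estimate in terms of norms, for continuous and compactly supported Fourier
transforms. -/
theorem exists_eLpNorm_freqSolution_le :
    ∃ C : ℝ≥0, ∀ h : Freq → ℂ, Continuous h → HasCompactSupport h →
      eLpNorm (freqSolution h) 4 spaceTimeMeasure ≤ C * eLpNorm h 2 freqMeasure := by
  obtain ⟨C, hC, hest⟩ := exists_lintegral_freqSynth_freqFlow_le
  lift C to ℝ≥0 using hC
  -- The constant `C + 1` replaces a fourth root of `C`, since `C ≤ (C + 1)⁴`.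
  refine ⟨C + 1, fun h hc hs => ?_⟩
  have h4 : eLpNorm (freqSolution h) 4 spaceTimeMeasure ^ 4 =
      ∫⁻ q, ‖freqSolution h q‖ₑ ^ 4 ∂spaceTimeMeasure := by
    have := eLpNorm_nnreal_pow_eq_lintegral (f := freqSolution h) (μ := spaceTimeMeasure) (p := 4)
      (by norm_num)
    simpa using this
  have hm := (continuous_freqSolution hc hs).measurable
  refine (ENNReal.pow_right_strictMono four_ne_zero).le_iff_le.1 ?_
  rw [h4, lintegral_spaceTimeMeasure (by fun_prop)]
  refine (hest h hc hs).trans ?_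
  rw [← eLpNorm_two_sq, mul_pow, ← pow_mul]
  gcongr
  have h1 : C ≤ (C + 1) ^ 4 := by
    calc C ≤ C + 1 := le_self_add
      _ ≤ (C + 1) ^ 4 := le_self_pow₀ le_add_self (by norm_num)
  exact_mod_cast h1

theorem theorem1p1 :
    ∃ C : ℝ≥0, ∀ φ : L2Cylinder,
      (∃ u : ℝ × Cylinder → ℂ, RepresentsFlow φ u) ∧
        ∀ u : ℝ × Cylinder → ℂ, RepresentsFlow φ u →
          eLpNorm u 4 spaceTimeMeasure ≤ (C : ℝ≥0∞) * eLpNorm φ 2 (volume : Measure Cylinder) := by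
  obtain ⟨C, hest⟩ := exists_eLpNorm_freqSolution_le
  refine ⟨C, fun φ => ⟨exists_representsFlow φ, fun u hu => ?_⟩⟩
  obtain ⟨h, hc, hs, happrox⟩ := exists_freqData_approx φ
  have hmeas := fun k => (continuous_freqSolution (hc k) (hs k)).aestronglyMeasurable
    (μ := spaceTimeMeasure)
  have hlim : Filter.Tendsto (fun k => eLpNorm (freqSolution (h k) - u) 2 spaceTimeMeasure)
      Filter.atTop (nhds 0) := by
    simp_rw [fun k => eLpNorm_freqSolution_sub (hc k) (hs k) hu]
    exact tendsto_of_tendsto_of_tendsto_of_le_of_le tendsto_const_nhds tendsto_inv_two_pow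
      (fun _ => zero_le) happrox
  obtain ⟨ns, hns, hae⟩ := (tendstoInMeasure_of_tendsto_eLpNorm (by norm_num) hmeas hu.1
    hlim).exists_seq_tendsto_ae
  -- Fatou's lemma: convergence in `L²` only gives almost everywhere convergence of a subsequence,
  -- and the `L⁴` norm is lower semicontinuous under it.
  refine (Lp.eLpNorm_lim_le_liminf_eLpNorm (fun k => hmeas (ns k)) u hae).trans ?_
  have hbound : ∀ k, eLpNorm (freqSolution (h (ns k))) 4 spaceTimeMeasure ≤
      C * ((2⁻¹ : ℝ≥0∞) ^ ns k + eLpNorm φ 2 (volume : Measure Cylinder)) := fun k => by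
    refine (hest _ (hc _) (hs _)).trans ?_
    gcongr
    calc eLpNorm (h (ns k)) 2 freqMeasure
        = eLpNorm ((h (ns k) - freqData φ) + freqData φ) 2 freqMeasure := by
          rw [sub_add_cancel]
      _ ≤ _ := (eLpNorm_add_le ((hc _).aestronglyMeasurable.sub
          (memLp_freqData φ).1) (memLp_freqData φ).1 (by norm_num)).trans
          (add_le_add (happrox _) (eLpNorm_freqData_le φ))
  refine (Filter.liminf_le_liminf (Filter.Eventually.of_forall hbound)).trans_eq ?_
  refine Filter.Tendsto.liminf_eq ?_
  have := ENNReal.Tendsto.const_mul (a := (C : ℝ≥0∞)) ((tendsto_inv_two_pow.comp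
    hns.tendsto_atTop).add_const (eLpNorm φ 2 (volume : Measure Cylinder)))
    (Or.inr ENNReal.coe_ne_top)
  simpa using this
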